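/- A graph $G$ is *3ECTF* if it is finite, triangle-free and 3-existentially complete: for all $B\subseteq A\subseteq V(G)$ with $|A|\le 3$ and $B$ independent, there is a vertex $v\notin A$ that is adjacent to every vertex of $B$ and to no vertex of $A\setminus B$. A tournament is *shattered* if any three of its vertices are contained in a four-vertex set inducing a copy of $T_4$ or of its reversal, where $T_4$ has vertices $0,1,2,3$ and arcs $0\to1$, $0\to2$, $0\to3$, $1\to2$, $2\to3$, $3\to1$. For $n\ge 2$ and $x\in\mathbb Z_2^n$ put $\tau(x_1,x_2,x_3,\dots,x_n)=(x_2,x_1+1,x_3,\dots,x_n)$, and let $d$ be the Hamming distance. For a tournament $T$ and positive integers $m,k$, the graph $G_T(m,k)$ has vertices $(i,j,x)$ with $i\in V(T)$, $1\le j\le m$, $x\in\mathbb Z_2^{3k-1}$, and its edges are given by - $(i,j,x)\sim(i,j,x')$ if $d(x,x')\in\{2k-1,2k+1,2k+2,\dots,3k-1\}$; - $(i,j,x)\sim(i,j',x')$ if $j\ne j'$ and $d(x,x')\in\{2k,\dots,3k-1\}$; - $(i,j,x)\sim(i',j',x')$ if $i\to i'$ in $T$ and $d(x,\tau(x'))\in\{2k,\dots,3k-1\}$.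 **Statement.** There is an absolute constant $c>0$ such that for every $\mu\in\mathbb N$ there are an integer $k\ge1$ and an $n_0$ such that, with $M=\max\{\mu,2\}$, for every $n\ge n_0$ there are at least $$2^{\,c\,n^2/(M\log M)^3}$$ pairwise nonisomorphic 3ECTF graphs with at most $n$ vertices in which every two distinct nonadjacent vertices have at least $\mu$ common neighbours. Moreover, these graphs can all be taken of the form $G_T(2,k)$ with $T$ a shattered tournament. -/

import Mathlib

/-- `G` is `k`-existentially complete: for all `B ⊆ A` with `|A| ≤ k` and `B` independent, there is
an additional vertex (outside `A`) adjacent to every vertex of `B` and to no vertex of `A \ B`. -/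
def IsExistentiallyComplete {V : Type*} (G : SimpleGraph V) (k : ℕ) : Prop :=
  ∀ A B : Finset V, B ⊆ A → A.card ≤ k → G.IsIndepSet (B : Set V) →
    ∃ v, v ∉ A ∧ (∀ b ∈ B, G.Adj v b) ∧ ∀ a ∈ A, a ∉ B → ¬ G.Adj v a

/-- A 3ECTF graph: finite, triangle-free and 3-existentially complete. -/
def Is3ECTF {V : Type*} (G : SimpleGraph V) : Prop :=
  Finite V ∧ G.CliqueFree 3 ∧ IsExistentiallyComplete G 3

/-- A tournament on `V`: an orientation of the complete graph on `V`. -/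
structure Tournament (V : Type*) where
  /-- `arc i j` means `i → j`. -/
  arc : V → V → Prop
  irrefl : ∀ i, ¬ arc i i
  asymm : ∀ i j, arc i j → ¬ arc j i
  total : ∀ i j, i ≠ j → arc i j ∨ arc j i

/-- The arcs of the tournament `T₄` on `{0, 1, 2, 3}`. -/
def T4Arc (u v : Fin 4) : Prop :=
  (u, v) ∈ ({(0, 1), (0, 2), (0, 3), (1, 2), (2, 3), (3, 1)} : Finset (Fin 4 × Fin 4))

/-- A tournament is shattered if every three of its vertices extend to a copy of `T₄` or of the
tournament obtained from `T₄` by reversing all arcs. -/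
def Tournament.IsShattered {V : Type*} (T : Tournament V) : Prop :=
  ∀ a b c : V, a ≠ b → a ≠ c → b ≠ c →
    ∃ f : Fin 4 ↪ V, a ∈ Set.range f ∧ b ∈ Set.range f ∧ c ∈ Set.range f ∧
      ((∀ u v, T.arc (f u) (f v) ↔ T4Arc u v) ∨ (∀ u v, T.arc (f u) (f v) ↔ T4Arc v u))

/-- The twist `τ(x₁, x₂, x₃, …, xₙ) = (x₂, x₁ + 1, x₃, …, xₙ)` of the hypercube `(ℤ/2)ⁿ`, `n ≥ 2`. -/
def twist {n : ℕ} (hn : 2 ≤ n) (x : Fin n → ZMod 2) : Fin n → ZMod 2 := fun i =>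
  if i.val = 0 then x ⟨1, by omega⟩
  else if i.val = 1 then x ⟨0, by omega⟩ + 1
  else x i

/-- The graph `G_T(m, k)`, `k ≥ 1`, on the triples `(i, j, x)` with `i` a vertex of `T`,
`j` one of `m` indices and `x ∈ (ℤ/2)^(3k-1)`; adjacency is the symmetric closure of the relation
given here. -/
def twistedGraph {V : Type*} (T : Tournament V) (m k : ℕ) (hk : 1 ≤ k) :
    SimpleGraph (V × Fin m × (Fin (3 * k - 1) → ZMod 2)) :=
  SimpleGraph.fromRel fun p q =>
    (p.1 = q.1 ∧ p.2.1 = q.2.1 ∧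
      (hammingDist p.2.2 q.2.2 = 2 * k - 1 ∨
        hammingDist p.2.2 q.2.2 ∈ Finset.Icc (2 * k + 1) (3 * k - 1))) ∨
    (p.1 = q.1 ∧ p.2.1 ≠ q.2.1 ∧ hammingDist p.2.2 q.2.2 ∈ Finset.Icc (2 * k) (3 * k - 1)) ∨
    (T.arc p.1 q.1 ∧
      hammingDist p.2.2 (twist (by omega) q.2.2) ∈ Finset.Icc (2 * k) (3 * k - 1))

/-! Call the cube over a pair (i, j) a cell. The first two cube coordinates form a 4-cycle, on which
`twist` is rotation by one step. Hence a tournament vertex `w` can view all cubes in one frame,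
rotating each by its sign relative to `w`. Distances to the cubes over `w` are then the ones that
define adjacency (`twistDist`). A distance between cubes over two further tournament vertices is off
by exactly one.

By `adj_antipode_iff`, the antipode of `u` in a cell over `w` is adjacent to a vertex outside that
cell iff `u` is within k-1 of it in the frame of `w`; inside the cell the allowed distances are k
and those at most k-2. So common neighbours are centres of small balls. A triple in the cube has
even perimeter at most 2(3k-1), which excludes triangles. Conversely, points at pairwise distance at
most 2k-2 have a centre of radius k-1, and the exceptional radius k inside a cell serves the pairs
at distance 2k-1 or 2k. The critical case is an independent triple over three different tournament
vertices (`hasCommonNeighbor_of_ne`): its own three frames may each lengthen the opposite distance,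
and then the fourth vertex given by shattering has a frame that shortens all three.

Existential completeness for |B| = 3 is this statement; |B| = 2 reduces to it by triangle-freeness,
and |B| ≤ 1 is a direct choice of a cube point.

For the count, T is recovered from the labelled graph G_T(2,k), and by a union bound at least half
of all tournaments on t vertices are shattered once t is large. Dividing by the number of
relabellings, (tA)! with A = 2^(3k), costs only 2^(O(t log t)) for fixed k, against at least
2^(⌊t/2⌋²) tournaments. The codegree is at least half the central binomial coefficient of k-1, so k
can be chosen with 4^k = O(M log M), that is A² = O((M log M)^3). -/

/-! ### Hamming geometry of the cube -/

/-- The cube vertex obtained from `y` by flipping the coordinates in `S`. -/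
def cubeFlip {n : ℕ} (y : Fin n → ZMod 2) (S : Finset (Fin n)) : Fin n → ZMod 2 := fun i =>
  if i ∈ S then y i + 1 else y i

/-- The set of coordinates in which two cube vertices differ. -/
def cubeDiff {n : ℕ} (x y : Fin n → ZMod 2) : Finset (Fin n) :=
  Finset.univ.filter fun i => x i ≠ y i

theorem card_cubeDiff {n : ℕ} (x y : Fin n → ZMod 2) :
    (cubeDiff x y).card = hammingDist x y := rfl

theorem cubeFlip_injective {n : ℕ} (y : Fin n → ZMod 2) : Function.Injective (cubeFlip y) := by
  intro S S' h
  ext i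
  have hi := congrFun h i
  simp only [cubeFlip] at hi
  by_cases h1 : i ∈ S <;> by_cases h2 : i ∈ S' <;> simp_all

theorem hammingDist_cubeFlip {n : ℕ} (x y : Fin n → ZMod 2) (S : Finset (Fin n)) :
    hammingDist (cubeFlip x S) y + 2 * (S ∩ cubeDiff x y).card = hammingDist x y + S.card := by
  have h1 : (S ∩ cubeDiff x y).card =
      ∑ i : Fin n, if i ∈ S ∧ x i ≠ y i then 1 else 0 := by
    rw [← Finset.card_filter]
    congr 1
    ext i
    simp [cubeDiff]
  have h2 : S.card = ∑ i : Fin n, if i ∈ S then 1 else 0 := by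
    rw [← Finset.card_filter]
    congr 1
    ext i
    simp
  rw [h1, h2]
  simp only [hammingDist, Finset.card_filter]
  rw [Finset.mul_sum, ← Finset.sum_add_distrib, ← Finset.sum_add_distrib]
  refine Finset.sum_congr rfl fun i _ => ?_
  have key : ∀ a b : ZMod 2, (a + 1 ≠ b ↔ a = b) := by decide
  by_cases h : i ∈ S <;> by_cases h' : x i = y i <;> simp [cubeFlip, h, h', key]

theorem hammingDist_cubeFlip_self {n : ℕ} (x : Fin n → ZMod 2) (S : Finset (Fin n)) :
    hammingDist (cubeFlip x S) x = S.card := by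
  have h := hammingDist_cubeFlip x x S
  have h0 : S ∩ cubeDiff x x = ∅ := by ext; simp [cubeDiff]
  simpa [h0] using h

/-- The antipode of a cube vertex. -/
def antipode {n : ℕ} (x : Fin n → ZMod 2) : Fin n → ZMod 2 := fun i => x i + 1

theorem hammingDist_antipode {n : ℕ} (x y : Fin n → ZMod 2) :
    hammingDist (antipode x) y + hammingDist x y = n := by
  have h := hammingDist_cubeFlip x y Finset.univ
  have h1 : cubeFlip x Finset.univ = antipode x := by ext; simp [cubeFlip, antipode]
  rw [h1, Finset.univ_inter, card_cubeDiff, Finset.card_univ, Fintype.card_fin] at h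
  omega

theorem antipode_injective {n : ℕ} : Function.Injective (antipode (n := n)) := by
  intro x y h
  ext i
  exact add_right_cancel (congrFun h i)

/-- The relative position of three cube vertices: `p₀` coordinates are common to all, and in `pᵢ`
coordinates the `i`-th vertex is the odd one out. Any number of coordinates of each of the four
types may be flipped. -/
theorem exists_cube_regions {n : ℕ} (y₁ y₂ y₃ : Fin n → ZMod 2) :
    ∃ p₀ p₁ p₂ p₃ : ℕ, p₀ + p₁ + p₂ + p₃ = n ∧ hammingDist y₁ y₂ = p₁ + p₂ ∧
      hammingDist y₁ y₃ = p₁ + p₃ ∧ hammingDist y₂ y₃ = p₂ + p₃ ∧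
      ∀ s₀ s₁ s₂ s₃, s₀ ≤ p₀ → s₁ ≤ p₁ → s₂ ≤ p₂ → s₃ ≤ p₃ →
        ∃ u, hammingDist u y₁ = s₀ + s₁ + s₂ + s₃ ∧
          hammingDist u y₂ + s₁ + s₂ = p₁ + p₂ + s₀ + s₃ ∧
          hammingDist u y₃ + s₁ + s₃ = p₁ + p₃ + s₀ + s₂ := by
  set P₀ := Finset.univ.filter fun i => y₁ i = y₂ i ∧ y₁ i = y₃ i with hP₀
  set P₁ := Finset.univ.filter fun i => y₁ i ≠ y₂ i ∧ y₁ i ≠ y₃ i with hP₁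
  set P₂ := Finset.univ.filter fun i => y₁ i ≠ y₂ i ∧ y₁ i = y₃ i with hP₂
  set P₃ := Finset.univ.filter fun i => y₁ i = y₂ i ∧ y₁ i ≠ y₃ i with hP₃
  have key : ∀ a b c : ZMod 2, a ≠ b → a ≠ c → b = c := by decide
  have key' : ∀ a b c : ZMod 2, (if a = b ∧ a = c then 1 else 0) +
      (if a ≠ b ∧ a ≠ c then 1 else 0) + (if a ≠ b ∧ a = c then 1 else 0) +
      (if a = b ∧ a ≠ c then 1 else 0) = 1 := by decide
  have h12 : hammingDist y₁ y₂ = P₁.card + P₂.card := by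
    simp only [hammingDist, hP₁, hP₂, Finset.card_filter]
    rw [← Finset.sum_add_distrib]
    refine Finset.sum_congr rfl fun i _ => ?_
    by_cases h : y₁ i = y₂ i <;> by_cases h' : y₁ i = y₃ i <;> simp [h, h']
  have h13 : hammingDist y₁ y₃ = P₁.card + P₃.card := by
    simp only [hammingDist, hP₁, hP₃, Finset.card_filter]
    rw [← Finset.sum_add_distrib]
    refine Finset.sum_congr rfl fun i _ => ?_
    by_cases h : y₁ i = y₂ i <;> by_cases h' : y₁ i = y₃ i <;> simp [h, h']
  have h23 : hammingDist y₂ y₃ = P₂.card + P₃.card := by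
    simp only [hammingDist, hP₂, hP₃, Finset.card_filter]
    rw [← Finset.sum_add_distrib]
    refine Finset.sum_congr rfl fun i _ => ?_
    have := key (y₁ i) (y₂ i) (y₃ i)
    by_cases h : y₁ i = y₂ i <;> by_cases h' : y₁ i = y₃ i <;> simp_all [eq_comm]
  have hn : P₀.card + P₁.card + P₂.card + P₃.card = n := by
    have h0 : n = ∑ _i : Fin n, 1 := by simp
    conv_rhs => rw [h0]
    simp only [hP₀, hP₁, hP₂, hP₃, Finset.card_filter]
    rw [← Finset.sum_add_distrib, ← Finset.sum_add_distrib, ← Finset.sum_add_distrib]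
    refine Finset.sum_congr rfl fun i _ => ?_
    exact key' _ _ _
  refine ⟨P₀.card, P₁.card, P₂.card, P₃.card, hn, h12, h13, h23, ?_⟩
  intro s₀ s₁ s₂ s₃ hs₀ hs₁ hs₂ hs₃
  obtain ⟨S₀, hS₀, rfl⟩ := Finset.exists_subset_card_eq hs₀
  obtain ⟨S₁, hS₁, rfl⟩ := Finset.exists_subset_card_eq hs₁
  obtain ⟨S₂, hS₂, rfl⟩ := Finset.exists_subset_card_eq hs₂
  obtain ⟨S₃, hS₃, rfl⟩ := Finset.exists_subset_card_eq hs₃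
  have m₀ : ∀ i ∈ S₀, y₁ i = y₂ i ∧ y₁ i = y₃ i := fun i hi => by simpa [hP₀] using hS₀ hi
  have m₁ : ∀ i ∈ S₁, y₁ i ≠ y₂ i ∧ y₁ i ≠ y₃ i := fun i hi => by simpa [hP₁] using hS₁ hi
  have m₂ : ∀ i ∈ S₂, y₁ i ≠ y₂ i ∧ y₁ i = y₃ i := fun i hi => by simpa [hP₂] using hS₂ hi
  have m₃ : ∀ i ∈ S₃, y₁ i = y₂ i ∧ y₁ i ≠ y₃ i := fun i hi => by simpa [hP₃] using hS₃ hi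
  have d12 : Disjoint S₁ S₂ := Finset.disjoint_left.2 fun i a b => (m₁ i a).2 (m₂ i b).2
  have d13 : Disjoint S₁ S₃ := Finset.disjoint_left.2 fun i a b => (m₁ i a).1 (m₃ i b).1
  have d03 : Disjoint S₀ S₃ := Finset.disjoint_left.2 fun i a b => (m₃ i b).2 (m₀ i a).2
  have d0 : Disjoint (S₀ ∪ S₃) (S₁ ∪ S₂) := by
    refine Finset.disjoint_left.2 fun i a b => ?_
    rcases Finset.mem_union.1 a with a | a <;> rcases Finset.mem_union.1 b with b | b
    · exact (m₁ i b).1 (m₀ i a).1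
    · exact (m₂ i b).1 (m₀ i a).1
    · exact (m₁ i b).1 (m₃ i a).1
    · exact (m₂ i b).1 (m₃ i a).1
  have hc : ((S₀ ∪ S₃) ∪ (S₁ ∪ S₂)).card = S₀.card + S₁.card + S₂.card + S₃.card := by
    rw [Finset.card_union_of_disjoint d0, Finset.card_union_of_disjoint d03,
      Finset.card_union_of_disjoint d12]
    ring
  have i2 : ((S₀ ∪ S₃) ∪ (S₁ ∪ S₂)) ∩ cubeDiff y₁ y₂ = S₁ ∪ S₂ := by
    ext i
    have := m₀ i; have := m₁ i; have := m₂ i; have := m₃ i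
    simp only [cubeDiff, Finset.mem_inter, Finset.mem_union, Finset.mem_filter, Finset.mem_univ,
      true_and]
    tauto
  have i3 : ((S₀ ∪ S₃) ∪ (S₁ ∪ S₂)) ∩ cubeDiff y₁ y₃ = S₁ ∪ S₃ := by
    ext i
    have := m₀ i; have := m₁ i; have := m₂ i; have := m₃ i
    simp only [cubeDiff, Finset.mem_inter, Finset.mem_union, Finset.mem_filter, Finset.mem_univ,
      true_and]
    tauto
  refine ⟨cubeFlip y₁ ((S₀ ∪ S₃) ∪ (S₁ ∪ S₂)), ?_, ?_, ?_⟩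
  · rw [hammingDist_cubeFlip_self, hc]
  · have := hammingDist_cubeFlip y₁ y₂ ((S₀ ∪ S₃) ∪ (S₁ ∪ S₂))
    rw [i2, hc, Finset.card_union_of_disjoint d12] at this
    omega
  · have := hammingDist_cubeFlip y₁ y₃ ((S₀ ∪ S₃) ∪ (S₁ ∪ S₂))
    rw [i3, hc, Finset.card_union_of_disjoint d13] at this
    omega

/-- Flip any `a` of the coordinates in which the two points differ. This counts common neighbours at
the critical distances 2k-1 and 2k. -/
theorem choose_le_card_geodesic {n : ℕ} (y₁ y₂ : Fin n → ZMod 2) (a b : ℕ)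
    (h : hammingDist y₁ y₂ = a + b) :
    (a + b).choose a ≤ (Finset.univ.filter fun u : Fin n → ZMod 2 =>
      hammingDist u y₁ = a ∧ hammingDist u y₂ = b).card := by
  rw [← h, ← card_cubeDiff, ← Finset.card_powersetCard]
  refine Finset.card_le_card_of_injOn (cubeFlip y₁) ?_ (cubeFlip_injective y₁).injOn
  intro S hS
  rw [Finset.mem_coe, Finset.mem_powersetCard] at hS
  have h2 := hammingDist_cubeFlip y₁ y₂ S
  rw [Finset.inter_eq_left.2 hS.1] at h2
  have h1 := hammingDist_cubeFlip_self y₁ S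
  simp only [Finset.coe_filter, Finset.mem_univ, true_and, Set.mem_ofPred_eq]
  omega

/-- Enlarge the set of differing coordinates to a set `Z` of size 2r. For an r-subset S of `Z`,
flipping S or its complement in `Z` moves `y₁` by r, and the two resulting distances to `y₂` add up
to 2r. So one set of each complementary pair is good. -/
theorem centralBinom_le_card_balls {n r : ℕ} (hr : 2 * r ≤ n) (y₁ y₂ : Fin n → ZMod 2)
    (h : hammingDist y₁ y₂ ≤ 2 * r) :
    r.centralBinom ≤ 2 * (Finset.univ.filter fun u : Fin n → ZMod 2 =>
      hammingDist u y₁ ≤ r ∧ hammingDist u y₂ ≤ r).card := by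
  obtain ⟨Z, hDZ, -, hZ⟩ := Finset.exists_subsuperset_card_eq
    (Finset.subset_univ (cubeDiff y₁ y₂)) h (by simpa using hr)
  set X := Z.powersetCard r
  set G := X.filter fun S => hammingDist (cubeFlip y₁ S) y₂ ≤ r
  have hX : X.card = r.centralBinom := by
    rw [Finset.card_powersetCard, hZ, Nat.centralBinom]
  have hsub : X ⊆ G ∪ G.image fun S => Z \ S := by
    intro S hS
    have hS' := Finset.mem_powersetCard.1 hS
    rw [Finset.mem_union, Finset.mem_image]
    by_cases hle : hammingDist (cubeFlip y₁ S) y₂ ≤ r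
    · exact Or.inl (Finset.mem_filter.2 ⟨hS, hle⟩)
    · refine Or.inr ⟨Z \ S, Finset.mem_filter.2 ⟨?_, ?_⟩, ?_⟩
      · rw [Finset.mem_powersetCard, Finset.card_sdiff_of_subset hS'.1]
        exact ⟨Finset.sdiff_subset, by omega⟩
      · have h1 := hammingDist_cubeFlip y₁ y₂ S
        have h2 := hammingDist_cubeFlip y₁ y₂ (Z \ S)
        have h3 : (S ∩ cubeDiff y₁ y₂).card + ((Z \ S) ∩ cubeDiff y₁ y₂).card
            = hammingDist y₁ y₂ := by
          rw [← Finset.card_union_of_disjoint, ← Finset.union_inter_distrib_right,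
            Finset.union_sdiff_of_subset hS'.1, Finset.inter_eq_right.2 hDZ, card_cubeDiff]
          exact Finset.disjoint_sdiff.mono Finset.inter_subset_left Finset.inter_subset_left
        rw [Finset.card_sdiff_of_subset hS'.1] at h2
        omega
      · simp [Finset.inter_eq_right.2 hS'.1]
  have hG : G.card ≤ (Finset.univ.filter fun u : Fin n → ZMod 2 =>
      hammingDist u y₁ ≤ r ∧ hammingDist u y₂ ≤ r).card := by
    refine Finset.card_le_card_of_injOn (cubeFlip y₁) ?_ (cubeFlip_injective y₁).injOn
    intro S hS
    obtain ⟨hS, hle⟩ := Finset.mem_filter.1 hS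
    have := (Finset.mem_powersetCard.1 hS).2
    simpa [hammingDist_cubeFlip_self, this] using hle
  calc r.centralBinom = X.card := hX.symm
    _ ≤ (G ∪ G.image fun S => Z \ S).card := Finset.card_le_card hsub
    _ ≤ G.card + (G.image fun S => Z \ S).card := Finset.card_union_le _ _
    _ ≤ G.card + G.card := Nat.add_le_add_left Finset.card_image_le _
    _ ≤ _ := by omega

/-! ### The 4-cycle of the first two coordinates and its rotations -/

/-- The position in the 4-cycle `(ℤ/2)²` of the first two coordinates of a cube vertex. -/
def cubeAngle {n : ℕ} (hn : 2 ≤ n) (x : Fin n → ZMod 2) : ZMod 4 :=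
  if x ⟨0, by omega⟩ = 0 then (if x ⟨1, by omega⟩ = 0 then 0 else 1)
  else if x ⟨1, by omega⟩ = 0 then 3 else 2

/-- The Hamming distance of two cube vertices outside the first two coordinates. -/
def tailDist {n : ℕ} (x y : Fin n → ZMod 2) : ℕ :=
  (Finset.univ.filter fun i : Fin n => 2 ≤ i.val ∧ x i ≠ y i).card

/-- The distance to `0` in the 4-cycle `ℤ/4`. -/
def cycleNorm (s : ZMod 4) : ℕ := if s = 0 then 0 else if s = 2 then 2 else 1

theorem hammingDist_eq_cycleNorm_add {n : ℕ} (hn : 2 ≤ n) (x y : Fin n → ZMod 2) :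
    hammingDist x y = cycleNorm (cubeAngle hn x - cubeAngle hn y) + tailDist x y := by
  obtain ⟨m, rfl⟩ : ∃ m, n = m + 2 := ⟨n - 2, by omega⟩
  have key : ∀ a b c d : ZMod 2, ((if a ≠ c then 1 else 0) + (if b ≠ d then 1 else 0) : ℕ) =
      cycleNorm ((if a = 0 then (if b = 0 then 0 else 1) else if b = 0 then 3 else 2) -
        (if c = 0 then (if d = 0 then 0 else 1) else if d = 0 then 3 else 2)) := by decide
  simp only [hammingDist, tailDist, Finset.card_filter, Fin.sum_univ_succ, cubeAngle]
  rw [← add_assoc]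
  have h0 : (⟨0, by omega⟩ : Fin (m + 2)) = 0 := rfl
  have h1 : (⟨1, by omega⟩ : Fin (m + 2)) = Fin.succ 0 := rfl
  simp only [h0, h1]
  rw [key]
  simp

theorem cubeAngle_twist {n : ℕ} (hn : 2 ≤ n) (x : Fin n → ZMod 2) :
    cubeAngle hn (twist hn x) = cubeAngle hn x + 1 := by
  have key : ∀ a b : ZMod 2,
      (if b = 0 then (if a + 1 = 0 then 0 else 1) else if a + 1 = 0 then 3 else 2 : ZMod 4) =
      (if a = 0 then (if b = 0 then 0 else 1) else if b = 0 then 3 else 2) + 1 := by decide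
  simpa [cubeAngle, twist] using key _ _

theorem tailDist_twist {n : ℕ} (hn : 2 ≤ n) (x y : Fin n → ZMod 2) :
    tailDist (twist hn x) y = tailDist x y := by
  unfold tailDist
  congr 1
  refine Finset.filter_congr fun i _ => and_congr_right fun h => ?_
  have h0 : i.val ≠ 0 := by omega
  have h1 : i.val ≠ 1 := by omega
  simp [twist, h0, h1]

theorem tailDist_comm {n : ℕ} (x y : Fin n → ZMod 2) : tailDist x y = tailDist y x := by
  simp [tailDist, ne_comm]

/-- Rotation of the first two coordinates: the power `τ ^ s` of the twist. -/
def cubeRot {n : ℕ} (hn : 2 ≤ n) (s : ZMod 4) : (Fin n → ZMod 2) → Fin n → ZMod 2 :=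
  (twist hn)^[s.val]

theorem cubeAngle_cubeRot {n : ℕ} (hn : 2 ≤ n) (s : ZMod 4) (x : Fin n → ZMod 2) :
    cubeAngle hn (cubeRot hn s x) = cubeAngle hn x + s := by
  have h : ∀ m : ℕ, cubeAngle hn ((twist hn)^[m] x) = cubeAngle hn x + m := by
    intro m
    induction m with
    | zero => simp
    | succ m ih =>
      rw [Function.iterate_succ_apply', cubeAngle_twist, ih]
      push_cast
      ring
  rw [cubeRot, h]
  simp

theorem tailDist_cubeRot {n : ℕ} (hn : 2 ≤ n) (s : ZMod 4) (x y : Fin n → ZMod 2) :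
    tailDist (cubeRot hn s x) y = tailDist x y := by
  have h : ∀ m : ℕ, tailDist ((twist hn)^[m] x) y = tailDist x y := by
    intro m
    induction m with
    | zero => simp
    | succ m ih => rw [Function.iterate_succ_apply', tailDist_twist, ih]
  exact h _

theorem hammingDist_cubeRot {n : ℕ} (hn : 2 ≤ n) (s s' : ZMod 4) (x y : Fin n → ZMod 2) :
    hammingDist (cubeRot hn s x) (cubeRot hn s' y) =
      cycleNorm (cubeAngle hn x + s - (cubeAngle hn y + s')) + tailDist x y := by
  rw [hammingDist_eq_cycleNorm_add hn, cubeAngle_cubeRot, cubeAngle_cubeRot, tailDist_cubeRot,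
    tailDist_comm, tailDist_cubeRot, tailDist_comm]

/-! ### Centres, far points and separating points for triples in the cube -/

/-- The majority point has distance pᵢ to the i-th point. At most one pᵢ exceeds k-1; if one does,
move from the majority towards that point until the distance is k-1. The truncated subtractions in
the witness cover all cases at once. -/
theorem exists_cube_center {n k : ℕ} (y₁ y₂ y₃ : Fin n → ZMod 2)
    (h12 : hammingDist y₁ y₂ + 2 ≤ 2 * k) (h13 : hammingDist y₁ y₃ + 2 ≤ 2 * k)
    (h23 : hammingDist y₂ y₃ + 2 ≤ 2 * k) :
    ∃ u, hammingDist u y₁ + 1 ≤ k ∧ hammingDist u y₂ + 1 ≤ k ∧ hammingDist u y₃ + 1 ≤ k := by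
  obtain ⟨p₀, p₁, p₂, p₃, hn, e12, e13, e23, H⟩ := exists_cube_regions y₁ y₂ y₃
  obtain ⟨u, hu⟩ : ∃ u, hammingDist u y₁ = (p₁ - (p₁ - (k - 1))) + (p₂ - (k - 1)) + (p₃ - (k - 1)) ∧
      hammingDist u y₂ + (p₁ - (p₁ - (k - 1))) + (p₂ - (k - 1)) = p₁ + p₂ + (p₃ - (k - 1)) ∧
      hammingDist u y₃ + (p₁ - (p₁ - (k - 1))) + (p₃ - (k - 1)) = p₁ + p₃ + (p₂ - (k - 1)) := by
    simpa using H 0 (p₁ - (p₁ - (k - 1))) (p₂ - (k - 1)) (p₃ - (k - 1)) (by omega) (by omega)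
      (by omega) (by omega)
  exact ⟨u, by omega, by omega, by omega⟩

/-- The centre lies on a geodesic from `y₁` to `y₂` and first uses the coordinates in which `y₁` is
the odd one out. The hypotheses force p₃ < p₁, which is what makes `y₃` close enough. -/
theorem exists_cube_center_of_odd {n k : ℕ} (y₁ y₂ y₃ : Fin n → ZMod 2)
    (h12 : hammingDist y₁ y₂ + 1 = 2 * k) (h13 : hammingDist y₁ y₃ + 1 ≤ 2 * k)
    (h23 : hammingDist y₂ y₃ + 2 ≤ 2 * k) :
    ∃ u, hammingDist u y₁ = k ∧ hammingDist u y₂ + 1 ≤ k ∧ hammingDist u y₃ + 1 ≤ k := by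
  obtain ⟨p₀, p₁, p₂, p₃, hn, e12, e13, e23, H⟩ := exists_cube_regions y₁ y₂ y₃
  by_cases hp : k ≤ p₁
  · obtain ⟨u, hu⟩ := H 0 k 0 0 (by omega) (by omega) (by omega) (by omega)
    exact ⟨u, by omega, by omega, by omega⟩
  · obtain ⟨u, hu⟩ := H 0 p₁ (k - p₁) 0 (by omega) (by omega) (by omega) (by omega)
    exact ⟨u, by omega, by omega, by omega⟩

/-- The exact distance to `y₃` is needed, since inside a cell the radius k-1 is forbidden: a maximum
of 2k gives k, and a maximum of at most 2k-2 gives at most k-2. -/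
theorem exists_cube_center_of_even {n k : ℕ} (y₁ y₂ y₃ : Fin n → ZMod 2)
    (h12 : hammingDist y₁ y₂ = 2 * k) :
    ∃ u, hammingDist u y₁ = k ∧ hammingDist u y₂ = k ∧
      hammingDist u y₃ + k = max (hammingDist y₁ y₃) (hammingDist y₂ y₃) := by
  obtain ⟨p₀, p₁, p₂, p₃, hn, e12, e13, e23, H⟩ := exists_cube_regions y₁ y₂ y₃
  by_cases hp : k ≤ p₁
  · obtain ⟨u, hu⟩ := H 0 k 0 0 (by omega) (by omega) (by omega) (by omega)
    exact ⟨u, by omega, by omega, by omega⟩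
  · obtain ⟨u, hu⟩ := H 0 p₁ (k - p₁) 0 (by omega) (by omega) (by omega) (by omega)
    exact ⟨u, by omega, by omega, by omega⟩

/-- The antipode of the majority point has distance n - pᵢ to the i-th point, which is enough unless
pᵢ ≥ 2k. This happens for at most one i, and then that block is split in half. -/
theorem exists_cube_far {n k : ℕ} (hn : n + 1 = 3 * k) (y₁ y₂ y₃ : Fin n → ZMod 2) :
    ∃ u, k ≤ hammingDist u y₁ ∧ k ≤ hammingDist u y₂ ∧ k ≤ hammingDist u y₃ := by
  obtain ⟨p₀, p₁, p₂, p₃, hp, e12, e13, e23, H⟩ := exists_cube_regions y₁ y₂ y₃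
  obtain ⟨u, hu⟩ := H p₀ (if 2 * k ≤ p₁ then p₁ / 2 else 0) (if 2 * k ≤ p₂ then p₂ / 2 else p₂)
    (if 2 * k ≤ p₃ then p₃ / 2 else p₃) le_rfl (by split_ifs <;> omega) (by split_ifs <;> omega)
    (by split_ifs <;> omega)
  refine ⟨u, ?_, ?_, ?_⟩ <;> split_ifs at hu <;> omega

/-- The block sizes for `exists_cube_separating`. Flipping fewer than half of each nonempty block
gives strict inequalities; the last two clauses exclude the one situation in which the flipped point
becomes antipodal to `y₂` or `y₃`. -/
theorem exists_flip_sizes {k p₀ p₁ p₂ p₃ : ℕ} (hk : 7 ≤ k) (hp : p₀ + p₁ + p₂ + p₃ + 1 = 3 * k) :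
    ∃ s₀ s₁ s₂ s₃ : ℕ, s₀ ≤ p₀ ∧ 2 * s₁ ≤ p₁ - 1 ∧ 2 * s₂ ≤ p₂ - 1 ∧ 2 * s₃ ≤ p₃ - 1 ∧
      s₀ + s₁ + s₂ + s₃ = k ∧
      (p₁ + p₂ + 1 = 2 * k → 1 ≤ s₁ + s₂) ∧ (p₁ + p₃ + 1 = 2 * k → 1 ≤ s₁ + s₃) := by
  obtain ⟨m₁, h₁, h₁'⟩ : ∃ m, 2 * m ≤ p₁ - 1 ∧ p₁ ≤ 2 * m + 2 := ⟨(p₁ - 1) / 2, by omega, by omega⟩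
  obtain ⟨m₂, h₂, h₂'⟩ : ∃ m, 2 * m ≤ p₂ - 1 ∧ p₂ ≤ 2 * m + 2 := ⟨(p₂ - 1) / 2, by omega, by omega⟩
  obtain ⟨m₃, h₃, h₃'⟩ : ∃ m, 2 * m ≤ p₃ - 1 ∧ p₃ ≤ 2 * m + 2 := ⟨(p₃ - 1) / 2, by omega, by omega⟩
  suffices h : ∃ s₀ s₁ s₂ s₃ : ℕ, s₀ ≤ p₀ ∧ s₁ ≤ m₁ ∧ s₂ ≤ m₂ ∧ s₃ ≤ m₃ ∧
      s₀ + s₁ + s₂ + s₃ = k ∧ (1 ≤ s₁ ∨ (1 ≤ m₂ → 1 ≤ s₂) ∧ (1 ≤ m₃ → 1 ≤ s₃) ∧ m₁ = 0) by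
    obtain ⟨s₀, s₁, s₂, s₃, g₀, g₁, g₂, g₃, hs, h⟩ := h
    refine ⟨s₀, s₁, s₂, s₃, g₀, by omega, by omega, by omega, hs, fun e => ?_, fun e => ?_⟩
    · rcases h with h | ⟨h, -, h0⟩
      · omega
      · have := h (by omega)
        omega
    · rcases h with h | ⟨-, h, h0⟩
      · omega
      · have := h (by omega)
        omega
  -- As mᵢ ≥ (pᵢ - 2)/2, the right side is at least (3k - 7)/2. This is the source of the bound k ≥
  -- 7.
  have hm : k ≤ p₀ + m₁ + m₂ + m₃ := by omega
  clear h₁ h₁' h₂ h₂' h₃ h₃' hp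
  by_cases c₁ : 1 ≤ m₁
  · by_cases g₁ : k ≤ m₁
    · exact ⟨0, k, 0, 0, by omega, g₁, by omega, by omega, by omega, Or.inl (by omega)⟩
    by_cases g₂ : k ≤ m₁ + m₂
    · exact ⟨0, m₁, k - m₁, 0, by omega, le_rfl, by omega, by omega, by omega, Or.inl c₁⟩
    by_cases g₃ : k ≤ m₁ + m₂ + m₃
    · exact ⟨0, m₁, m₂, k - m₁ - m₂, by omega, le_rfl, le_rfl, by omega, by omega, Or.inl c₁⟩
    · exact ⟨k - m₁ - m₂ - m₃, m₁, m₂, m₃, by omega, le_rfl, le_rfl, le_rfl, by omega, Or.inl c₁⟩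
  obtain rfl : m₁ = 0 := by omega
  by_cases c₃ : 1 ≤ m₃
  · by_cases g₁ : k ≤ m₂
    · exact ⟨0, 0, k - 1, 1, by omega, le_rfl, by omega, by omega, by omega,
        Or.inr ⟨fun _ => by omega, fun _ => le_rfl, rfl⟩⟩
    by_cases g₂ : k ≤ m₂ + m₃
    · exact ⟨0, 0, m₂, k - m₂, by omega, le_rfl, le_rfl, by omega, by omega,
        Or.inr ⟨id, fun _ => by omega, rfl⟩⟩
    · exact ⟨k - m₂ - m₃, 0, m₂, m₃, by omega, le_rfl, le_rfl, le_rfl, by omega,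
        Or.inr ⟨id, id, rfl⟩⟩
  · by_cases g₁ : k ≤ m₂
    · exact ⟨0, 0, k, 0, by omega, le_rfl, g₁, by omega, by omega,
        Or.inr ⟨fun _ => by omega, fun _ => by omega, rfl⟩⟩
    · exact ⟨k - m₂, 0, m₂, 0, by omega, le_rfl, le_rfl, by omega, by omega,
        Or.inr ⟨id, fun _ => by omega, rfl⟩⟩

/-- Used in the cell of `y₁`: distance k makes the antipode of `u` adjacent to `y₁`. Distance at
least k prevents adjacency to a vertex of another cell; in the same cell this requires more than k,
and distance below n keeps the new vertex different from the old one. Here d(u, y₂) = k + (p₁ + p₂)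
- 2(s₁ + s₂). -/
theorem exists_cube_separating {n k : ℕ} (hk : 7 ≤ k) (hn : n + 1 = 3 * k)
    (y₁ y₂ y₃ : Fin n → ZMod 2) :
    ∃ u, hammingDist u y₁ = k ∧ (k ≤ hammingDist u y₂) ∧ (k ≤ hammingDist u y₃) ∧
      (y₁ ≠ y₂ → k < hammingDist u y₂ ∧ hammingDist u y₂ < n) ∧
      (y₁ ≠ y₃ → k < hammingDist u y₃ ∧ hammingDist u y₃ < n) := by
  obtain ⟨p₀, p₁, p₂, p₃, hp, e12, e13, e23, H⟩ := exists_cube_regions y₁ y₂ y₃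
  rw [← hammingDist_pos, ← hammingDist_pos (x := y₁) (y := y₃), e12, e13]
  obtain ⟨s₀, s₁, s₂, s₃, h₀, h₁, h₂, h₃, hs, ha, hb⟩ :=
    exists_flip_sizes (p₀ := p₀) (p₁ := p₁) (p₂ := p₂) (p₃ := p₃) hk (by omega)
  obtain ⟨u, hu₁, hu₂, hu₃⟩ := H s₀ s₁ s₂ s₃ h₀ (by omega) (by omega) (by omega)
  clear H e12 e13 e23
  refine ⟨u, by omega, by omega, by omega, fun _ => ⟨by omega, ?_⟩, fun _ => ⟨by omega, ?_⟩⟩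
  · by_contra hc
    have : p₁ + p₂ + 1 = 2 * k := by omega
    have := ha this
    omega
  · by_contra hc
    have : p₁ + p₃ + 1 = 2 * k := by omega
    have := hb this
    omega

/-- Each coordinate in which the three points are not all equal is counted exactly twice. -/
theorem hammingDist_triangle_even {n : ℕ} (y₁ y₂ y₃ : Fin n → ZMod 2) :
    ∃ m ≤ n, hammingDist y₁ y₂ + hammingDist y₁ y₃ + hammingDist y₂ y₃ = 2 * m := by
  obtain ⟨p₀, p₁, p₂, p₃, hn, e12, e13, e23, -⟩ := exists_cube_regions y₁ y₂ y₃
  exact ⟨p₁ + p₂ + p₃, by omega, by omega⟩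

/-! ### Tournament signs, frames and adjacency -/

section

variable {V : Type*} (T : Tournament V)

open Classical in
/-- `1` if `i → j`, `-1` if `j → i`, and `0` if `i = j`. -/
noncomputable def Tournament.sign (i j : V) : ZMod 4 :=
  if T.arc i j then 1 else if T.arc j i then -1 else 0

theorem Tournament.sign_self (i : V) : T.sign i i = 0 := by
  simp [Tournament.sign, T.irrefl]

theorem Tournament.sign_of_arc {i j : V} (h : T.arc i j) : T.sign i j = 1 := by
  simp [Tournament.sign, h]

theorem Tournament.sign_of_arc' {i j : V} (h : T.arc j i) : T.sign i j = -1 := by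
  simp [Tournament.sign, h, T.asymm _ _ h]

theorem Tournament.sign_swap (i j : V) : T.sign j i = -T.sign i j := by
  rcases eq_or_ne i j with rfl | h
  · simp [T.sign_self]
  · rcases T.total i j h with h | h
    · rw [T.sign_of_arc h, T.sign_of_arc' h]
    · rw [T.sign_of_arc h, T.sign_of_arc' h, neg_neg]

theorem Tournament.sign_of_ne {i j : V} (h : i ≠ j) : T.sign i j = 1 ∨ T.sign i j = -1 := by
  rcases T.total i j h with h | h
  · exact Or.inl (T.sign_of_arc h)
  · exact Or.inr (T.sign_of_arc' h)

/-- The switching-invariant form of the property of being shattered. -/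
theorem Tournament.IsShattered.exists_sign {T : Tournament V} (hT : T.IsShattered) {a b c : V}
    (hab : a ≠ b) (hac : a ≠ c) (hbc : b ≠ c) :
    ∃ w, w ≠ a ∧ w ≠ b ∧ w ≠ c ∧ ∃ ε : ZMod 4, (ε = 1 ∨ ε = -1) ∧
      T.sign a b = ε + T.sign w b - T.sign w a ∧ T.sign b c = ε + T.sign w c - T.sign w b ∧
      T.sign c a = ε + T.sign w a - T.sign w c := by
  obtain ⟨f, ⟨i, rfl⟩, ⟨j, rfl⟩, ⟨l, rfl⟩, hf⟩ := hT a b c hab hac hbc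
  let s : Fin 4 → Fin 4 → ZMod 4 := fun u v =>
    if (u, v) ∈ ({(0, 1), (0, 2), (0, 3), (1, 2), (2, 3), (3, 1)} : Finset (Fin 4 × Fin 4)) then 1
    else if (v, u) ∈ ({(0, 1), (0, 2), (0, 3), (1, 2), (2, 3), (3, 1)} : Finset (Fin 4 × Fin 4))
      then -1 else 0
  -- Whichever vertex of T₄ is `w`, switching so that `w` dominates the other three turns these into
  -- a cyclic triangle, with orientation `ε`. In ℤ/4, switching is the addition of 2 to a sign.
  have key : ∀ i j l : Fin 4, i ≠ j → i ≠ l → j ≠ l → ∃ w, w ≠ i ∧ w ≠ j ∧ w ≠ l ∧ ∃ ε : ZMod 4,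
      (ε = 1 ∨ ε = -1) ∧ s i j = ε + s w j - s w i ∧ s j l = ε + s w l - s w j ∧
      s l i = ε + s w i - s w l := by decide
  obtain ⟨w, wi, wj, wl, ε, hε, e1, e2, e3⟩ := key i j l (fun h => hab (h ▸ rfl))
    (fun h => hac (h ▸ rfl)) (fun h => hbc (h ▸ rfl))
  rcases hf with hf | hf
  · have hs : ∀ u v, T.sign (f u) (f v) = s u v := by
      intro u v
      simp only [Tournament.sign, hf, T4Arc, s]
    refine ⟨f w, f.injective.ne wi, f.injective.ne wj, f.injective.ne wl, ε, hε, ?_⟩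
    simp only [hs]
    exact ⟨e1, e2, e3⟩
  · have hs' : ∀ u v, s v u = - s u v := by decide
    have hs : ∀ u v, T.sign (f u) (f v) = - s u v := by
      intro u v
      rw [← hs']
      simp only [Tournament.sign, hf, T4Arc, s]
    refine ⟨f w, f.injective.ne wi, f.injective.ne wj, f.injective.ne wl, -ε, ?_, ?_⟩
    · rcases hε with rfl | rfl
      · exact Or.inr rfl
      · exact Or.inl rfl
    simp only [hs, e1, e2, e3]
    refine ⟨?_, ?_, ?_⟩ <;> ring

variable {k m : ℕ} (hk : 1 ≤ k)

/-- The Hamming distance of two vertices of `G_T(m, k)` seen from the tournament vertex `w`. -/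
noncomputable def frameDist (w : V) (p q : V × Fin m × (Fin (3 * k - 1) → ZMod 2)) : ℕ :=
  hammingDist (cubeRot (show 2 ≤ 3 * k - 1 by omega) (T.sign w p.1) p.2.2)
    (cubeRot (show 2 ≤ 3 * k - 1 by omega) (T.sign w q.1) q.2.2)

/-- The Hamming distance of two vertices of `G_T(m, k)` after the twist between their cubes. -/
noncomputable def twistDist (p q : V × Fin m × (Fin (3 * k - 1) → ZMod 2)) : ℕ :=
  frameDist T hk p.1 p q

variable (p q r : V × Fin m × (Fin (3 * k - 1) → ZMod 2))

theorem frameDist_comm (w : V) : frameDist T hk w p q = frameDist T hk w q p :=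
  hammingDist_comm _ _

theorem frameDist_eq (w : V) : frameDist T hk w p q =
    cycleNorm (cubeAngle (show 2 ≤ 3 * k - 1 by omega) p.2.2 + T.sign w p.1 -
      (cubeAngle (show 2 ≤ 3 * k - 1 by omega) q.2.2 + T.sign w q.1)) + tailDist p.2.2 q.2.2 :=
  hammingDist_cubeRot _ _ _ _ _

theorem frameDist_right : frameDist T hk q.1 p q = twistDist T hk p q := by
  rw [twistDist, frameDist_eq, frameDist_eq, T.sign_self, T.sign_self, T.sign_swap p.1 q.1]
  congr 2
  ring

theorem twistDist_comm : twistDist T hk p q = twistDist T hk q p := by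
  rw [← frameDist_right, frameDist_comm]
  rfl

theorem frameDist_of_eq {p q : V × Fin m × (Fin (3 * k - 1) → ZMod 2)} (h : p.1 = q.1) (w : V) :
    frameDist T hk w p q = twistDist T hk p q := by
  rw [twistDist, frameDist_eq, frameDist_eq, h]
  congr 2
  ring

theorem twistDist_of_eq {p q : V × Fin m × (Fin (3 * k - 1) → ZMod 2)} (h : p.1 = q.1) :
    twistDist T hk p q = hammingDist p.2.2 q.2.2 := by
  rw [twistDist, frameDist, ← h, T.sign_self]
  rfl

theorem twistDist_le : twistDist T hk p q ≤ 3 * k - 1 := by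
  simpa [twistDist, frameDist] using hammingDist_le_card_fintype (x := cubeRot (show 2 ≤ 3 * k - 1 by omega)
    (T.sign p.1 p.1) p.2.2) (y := cubeRot (show 2 ≤ 3 * k - 1 by omega) (T.sign p.1 q.1) q.2.2)

theorem twistDist_of_arc {p q : V × Fin m × (Fin (3 * k - 1) → ZMod 2)} (h : T.arc p.1 q.1) :
    twistDist T hk p q =
      hammingDist p.2.2 (twist (show 2 ≤ 3 * k - 1 by omega) q.2.2) := by
  rw [twistDist, frameDist, T.sign_self, T.sign_of_arc h]
  rfl

/-- Adjacency in `G_T(m, k)` in terms of the twisted distance. -/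
theorem twistedGraph_adj : (twistedGraph T m k hk).Adj p q ↔
    ((p.1 = q.1 ∧ p.2.1 = q.2.1) ∧
      (twistDist T hk p q + 1 = 2 * k ∨ 2 * k + 1 ≤ twistDist T hk p q)) ∨
    (¬ (p.1 = q.1 ∧ p.2.1 = q.2.1) ∧ 2 * k ≤ twistDist T hk p q) := by
  have hle := twistDist_le T hk p q
  rw [twistedGraph, SimpleGraph.fromRel_adj]
  by_cases h1 : p.1 = q.1
  · have e1 := twistDist_of_eq T hk h1
    have e2 : hammingDist q.2.2 p.2.2 = hammingDist p.2.2 q.2.2 := hammingDist_comm _ _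
    have hne : p ≠ q ↔ ¬ (p.2.1 = q.2.1 ∧ hammingDist p.2.2 q.2.2 = 0) := by
      rw [hammingDist_eq_zero, ne_eq, Prod.ext_iff, Prod.ext_iff]
      simp [h1]
    rw [e1] at hle ⊢
    by_cases h2 : p.2.1 = q.2.1
    · simp only [h1, h2, hne, e2, T.irrefl, true_and, false_and, or_false, Finset.mem_Icc,
        and_self, ne_eq, not_true]
      omega
    · simp only [h1, h2, Ne.symm h2, hne, e2, T.irrefl, true_and, false_and, Finset.mem_Icc,
        and_false, ne_eq, not_false_eq_true, false_or, or_false]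
      omega
  · have hne : p ≠ q := fun h => h1 (h ▸ rfl)
    simp only [h1, Ne.symm h1, hne, ne_eq, not_false_eq_true, false_and, false_or, true_and,
      Finset.mem_Icc]
    rcases T.total _ _ h1 with h | h
    · have h' := T.asymm _ _ h
      have e1 := twistDist_of_arc T hk h
      simp only [h, h', true_and, false_and, or_false]
      omega
    · have h' := T.asymm _ _ h
      have e1 := twistDist_of_arc T hk h
      rw [twistDist_comm] at e1
      simp only [h, h', true_and, false_and, false_or]
      omega

theorem twistDist_of_not_adj {p q : V × Fin m × (Fin (3 * k - 1) → ZMod 2)}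
    (h : ¬ (twistedGraph T m k hk).Adj p q) :
    ((p.1 = q.1 ∧ p.2.1 = q.2.1) ∧
      (twistDist T hk p q + 2 ≤ 2 * k ∨ twistDist T hk p q = 2 * k)) ∨
    (¬ (p.1 = q.1 ∧ p.2.1 = q.2.1) ∧ twistDist T hk p q + 1 ≤ 2 * k) := by
  rw [twistedGraph_adj] at h
  by_cases hc : p.1 = q.1 ∧ p.2.1 = q.2.1
  · exact Or.inl ⟨hc, by simp only [hc, true_and, not_true, false_and, or_false, and_self] at h; omega⟩
  · exact Or.inr ⟨hc, by simp only [hc, not_false_eq_true, true_and, false_and, false_or] at h; omega⟩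

variable (w : V) (l : Fin m) (u : Fin (3 * k - 1) → ZMod 2)

/-- Passing to the antipode replaces a distance d by 3k-1-d, so the thresholds 2k-1, 2k, 2k+1 become
k, k-1, k-2. -/
theorem adj_antipode_iff : (twistedGraph T m k hk).Adj (w, l, antipode u) q ↔
    ((w = q.1 ∧ l = q.2.1) ∧
      (hammingDist u (cubeRot (show 2 ≤ 3 * k - 1 by omega) (T.sign w q.1) q.2.2) = k ∨
      hammingDist u (cubeRot (show 2 ≤ 3 * k - 1 by omega) (T.sign w q.1) q.2.2) + 2 ≤ k)) ∨
    (¬ (w = q.1 ∧ l = q.2.1) ∧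
      hammingDist u (cubeRot (show 2 ≤ 3 * k - 1 by omega) (T.sign w q.1) q.2.2) + 1 ≤ k) := by
  have h := hammingDist_antipode u
    (cubeRot (show 2 ≤ 3 * k - 1 by omega) (T.sign w q.1) q.2.2)
  have h' : hammingDist (antipode u)
      (cubeRot (show 2 ≤ 3 * k - 1 by omega) (T.sign w q.1) q.2.2) =
        twistDist T hk (w, l, antipode u) q := by
    rw [twistDist, frameDist, T.sign_self]
    rfl
  rw [h'] at h
  rw [twistedGraph_adj]
  generalize hammingDist u _ = e at h ⊢
  generalize twistDist T hk _ _ = d at h ⊢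
  by_cases hc : w = q.1 ∧ l = q.2.1
  · simp only [hc, true_and, not_true, false_and, or_false, and_self]
    omega
  · simp only [hc, not_false_eq_true, true_and, false_and, false_or]
    omega

end

/-! ### Triangle-freeness and common neighbours of independent triples -/

section

variable {V : Type*} (T : Tournament V) {k : ℕ} (hk : 1 ≤ k)

theorem frameDist_triangle_even {m : ℕ} (w : V)
    (p q r : V × Fin m × (Fin (3 * k - 1) → ZMod 2)) :
    ∃ m ≤ 3 * k - 1,
      frameDist T hk w p q + frameDist T hk w p r + frameDist T hk w q r = 2 * m :=
  hammingDist_triangle_even _ _ _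

/-- The two relative angles differ by an odd element of ℤ/4, so they are neighbours on the 4-cycle
and their norms differ by one. -/
theorem twistDist_le_frameDist {m : ℕ} {p q r : V × Fin m × (Fin (3 * k - 1) → ZMod 2)}
    (hpq : p.1 ≠ q.1) (hpr : p.1 ≠ r.1) (hqr : q.1 ≠ r.1) :
    twistDist T hk q r ≤ frameDist T hk p.1 q r + 1 := by
  have key : ∀ x a b c : ZMod 4, (a = 1 ∨ a = -1) → (b = 1 ∨ b = -1) → (c = 1 ∨ c = -1) →
      cycleNorm (x - c) ≤ cycleNorm (x + (a - b)) + 1 := by decide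
  have h := key (cubeAngle (show 2 ≤ 3 * k - 1 by omega) q.2.2 -
    cubeAngle (show 2 ≤ 3 * k - 1 by omega) r.2.2) _ _ _ (T.sign_of_ne hpq) (T.sign_of_ne hpr)
    (T.sign_of_ne hqr)
  rw [twistDist, frameDist_eq, frameDist_eq, T.sign_self]
  rw [show ∀ a b c d : ZMod 4, a + c - (b + d) = a - b + (c - d) from fun _ _ _ _ => by ring, zero_sub, ← sub_eq_add_neg,
    show ∀ a b c d : ZMod 4, a + c - (b + d) = a - b + (c - d) from fun _ _ _ _ => by ring]
  omega

/-- The perimeter is even and at most 6k-2. If two tournament vertices coincide, all three adjacency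
distances occur in one frame, and a triangle has perimeter at least 6k-1, or 6k-3 (odd) if all sides
are 2k-1 in one cell. For distinct tournament vertices the sides are at least 2k and the frame loses
at most one, so the perimeter is again at least 6k-1. -/
theorem twistedGraph_cliqueFree {m : ℕ} : (twistedGraph T m k hk).CliqueFree 3 := by
  classical
  intro s hs
  obtain ⟨p, q, r, hpq, hpr, hqr, -⟩ := SimpleGraph.is3Clique_iff.1 hs
  obtain ⟨x, hx, e⟩ := frameDist_triangle_even T hk p.1 p q r
  have e12 : frameDist T hk p.1 p q = twistDist T hk p q := rfl
  have e13 : frameDist T hk p.1 p r = twistDist T hk p r := rfl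
  rw [twistedGraph_adj] at hpq hpr hqr
  by_cases hd : p.1 = q.1 ∨ p.1 = r.1 ∨ q.1 = r.1
  · have e23 : frameDist T hk p.1 q r = twistDist T hk q r := by
      rcases hd with h | h | h
      · rw [h]; rfl
      · rw [h, frameDist_right]
      · exact frameDist_of_eq T hk h _
    rw [e12, e13, e23] at e
    rcases hpq with ⟨c1, hpq⟩ | ⟨c1, hpq⟩ <;> rcases hpr with ⟨c2, hpr⟩ | ⟨c2, hpr⟩ <;>
      rcases hqr with ⟨c3, hqr⟩ | ⟨c3, hqr⟩
    · omega
    · exact c3 ⟨c1.1.symm.trans c2.1, c1.2.symm.trans c2.2⟩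
    · exact c2 ⟨c1.1.trans c3.1, c1.2.trans c3.2⟩
    · omega
    · exact c1 ⟨c2.1.trans c3.1.symm, c2.2.trans c3.2.symm⟩
    · omega
    · omega
    · omega
  · simp only [not_or] at hd
    have := twistDist_le_frameDist T hk hd.1 hd.2.1 hd.2.2
    rw [e12, e13] at e
    have h1 : 2 * k ≤ twistDist T hk p q := by
      rcases hpq with ⟨c, -⟩ | ⟨-, h⟩
      · exact absurd c.1 hd.1
      · exact h
    have h2 : 2 * k ≤ twistDist T hk p r := by
      rcases hpr with ⟨c, -⟩ | ⟨-, h⟩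
      · exact absurd c.1 hd.2.1
      · exact h
    have h3 : 2 * k ≤ twistDist T hk q r := by
      rcases hqr with ⟨c, -⟩ | ⟨-, h⟩
      · exact absurd c.1 hd.2.2
      · exact h
    omega

variable (p q r : V × Fin 2 × (Fin (3 * k - 1) → ZMod 2))

/-- Three vertices of `G` have a common neighbour. -/
def HasCommonNeighbor {W : Type*} (G : SimpleGraph W) (p q r : W) : Prop :=
  ∃ v, G.Adj v p ∧ G.Adj v q ∧ G.Adj v r

theorem HasCommonNeighbor.rotate {W : Type*} {G : SimpleGraph W} {p q r : W}
    (h : HasCommonNeighbor G p q r) : HasCommonNeighbor G q r p :=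
  let ⟨v, a, b, c⟩ := h
  ⟨v, b, c, a⟩

theorem HasCommonNeighbor.swap {W : Type*} {G : SimpleGraph W} {p q r : W}
    (h : HasCommonNeighbor G p q r) : HasCommonNeighbor G q p r :=
  let ⟨v, a, b, c⟩ := h
  ⟨v, b, a, c⟩

variable {p q r}

theorem hasCommonNeighbor_off_cells (w : V) (l : Fin 2) (cp : ¬ (w = p.1 ∧ l = p.2.1))
    (cq : ¬ (w = q.1 ∧ l = q.2.1)) (cr : ¬ (w = r.1 ∧ l = r.2.1))
    (hpq : frameDist T hk w p q + 2 ≤ 2 * k) (hpr : frameDist T hk w p r + 2 ≤ 2 * k)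
    (hqr : frameDist T hk w q r + 2 ≤ 2 * k) :
    HasCommonNeighbor (twistedGraph T 2 k hk) p q r := by
  obtain ⟨u, h1, h2, h3⟩ := exists_cube_center _ _ _ hpq hpr hqr
  exact ⟨(w, l, antipode u), (adj_antipode_iff ..).2 (Or.inr ⟨cp, h1⟩),
    (adj_antipode_iff ..).2 (Or.inr ⟨cq, h2⟩), (adj_antipode_iff ..).2 (Or.inr ⟨cr, h3⟩)⟩

/-- A pair at distance 2k-1 has no centre of radius k-1; the cell of `p` is used because there the
radius k to `p` is allowed. -/
theorem hasCommonNeighbor_of_odd (cq : ¬ (p.1 = q.1 ∧ p.2.1 = q.2.1))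
    (cr : ¬ (p.1 = r.1 ∧ p.2.1 = r.2.1)) (hpq : twistDist T hk p q + 1 = 2 * k)
    (hpr : twistDist T hk p r + 1 ≤ 2 * k) (hqr : frameDist T hk p.1 q r + 2 ≤ 2 * k) :
    HasCommonNeighbor (twistedGraph T 2 k hk) p q r := by
  obtain ⟨u, h1, h2, h3⟩ := exists_cube_center_of_odd _ _ _ hpq hpr hqr
  exact ⟨(p.1, p.2.1, antipode u), (adj_antipode_iff ..).2 (Or.inl ⟨⟨rfl, rfl⟩, Or.inl h1⟩),
    (adj_antipode_iff ..).2 (Or.inr ⟨cq, h2⟩), (adj_antipode_iff ..).2 (Or.inr ⟨cr, h3⟩)⟩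

theorem frameDist_left_eq (h : p.1 = q.1) (r : V × Fin 2 × (Fin (3 * k - 1) → ZMod 2)) :
    frameDist T hk p.1 q r = twistDist T hk q r := by
  rw [h]; rfl

theorem hasCommonNeighbor_of_even (cq : p.1 = q.1 ∧ p.2.1 = q.2.1)
    (hpq : twistDist T hk p q = 2 * k)
    (hpr : ¬ (twistedGraph T 2 k hk).Adj p r) (hqr : ¬ (twistedGraph T 2 k hk).Adj q r) :
    HasCommonNeighbor (twistedGraph T 2 k hk) p q r := by
  obtain ⟨u, h1, h2, h3⟩ := exists_cube_center_of_even _ _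
    (cubeRot (show 2 ≤ 3 * k - 1 by omega) (T.sign p.1 r.1) r.2.2) hpq
  have e1 : twistDist T hk p r = hammingDist
    (cubeRot (show 2 ≤ 3 * k - 1 by omega) (T.sign p.1 p.1) p.2.2)
    (cubeRot (show 2 ≤ 3 * k - 1 by omega) (T.sign p.1 r.1) r.2.2) := rfl
  have e2 : twistDist T hk q r = hammingDist
    (cubeRot (show 2 ≤ 3 * k - 1 by omega) (T.sign p.1 q.1) q.2.2)
    (cubeRot (show 2 ≤ 3 * k - 1 by omega) (T.sign p.1 r.1) r.2.2) := by
    rw [← frameDist_left_eq T hk cq.1]; rfl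
  rw [← e1, ← e2] at h3
  refine ⟨(p.1, p.2.1, antipode u), (adj_antipode_iff ..).2 (Or.inl ⟨⟨rfl, rfl⟩, Or.inl h1⟩),
    (adj_antipode_iff ..).2 (Or.inl ⟨cq, Or.inl h2⟩), (adj_antipode_iff ..).2 ?_⟩
  by_cases cr : p.1 = r.1 ∧ p.2.1 = r.2.1
  · refine Or.inl ⟨cr, ?_⟩
    rcases twistDist_of_not_adj T hk hpr with ⟨-, h⟩ | ⟨h, -⟩
    swap
    · exact absurd cr h
    rcases twistDist_of_not_adj T hk hqr with ⟨-, h'⟩ | ⟨h', -⟩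
    swap
    · exact absurd ⟨cq.1.symm.trans cr.1, cq.2.symm.trans cr.2⟩ h'
    omega
  · refine Or.inr ⟨cr, ?_⟩
    rcases twistDist_of_not_adj T hk hpr with ⟨h, -⟩ | ⟨-, h⟩
    · exact absurd h cr
    rcases twistDist_of_not_adj T hk hqr with ⟨h', -⟩ | ⟨-, h'⟩
    · exact absurd ⟨cq.1.trans h'.1, cq.2.trans h'.2⟩ cr
    omega

theorem fin_two_add_one_ne (j : Fin 2) : j + 1 ≠ j := by
  revert j; decide

/-- Three pairwise nonadjacent vertices, two of which are in the same cube. -/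
theorem hasCommonNeighbor_of_same_cell (hV : ∀ a : V, ∃ b, b ≠ a)
    (hc : p.1 = q.1 ∧ p.2.1 = q.2.1) (hpq : ¬ (twistedGraph T 2 k hk).Adj p q)
    (hpr : ¬ (twistedGraph T 2 k hk).Adj p r) (hqr : ¬ (twistedGraph T 2 k hk).Adj q r) :
    HasCommonNeighbor (twistedGraph T 2 k hk) p q r := by
  have hrp := hpr
  have hrq := hqr
  rw [SimpleGraph.adj_comm] at hrp hrq
  have dpq := twistDist_of_not_adj T hk hpq
  have dpr := twistDist_of_not_adj T hk hpr
  have dqr := twistDist_of_not_adj T hk hqr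
  by_cases hpq2 : twistDist T hk p q = 2 * k
  · exact hasCommonNeighbor_of_even T hk hc hpq2 hpr hqr
  replace dpq : twistDist T hk p q + 2 ≤ 2 * k := by
    rcases dpq with ⟨-, h⟩ | ⟨h, -⟩
    · omega
    · exact absurd hc h
  have hfr : ∀ w, frameDist T hk w p q + 2 ≤ 2 * k := fun w => by
    rwa [frameDist_of_eq T hk hc.1]
  by_cases cr : p.1 = r.1 ∧ p.2.1 = r.2.1
  · have cr' : q.1 = r.1 ∧ q.2.1 = r.2.1 := ⟨hc.1.symm.trans cr.1, hc.2.symm.trans cr.2⟩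
    by_cases hpr2 : twistDist T hk p r = 2 * k
    · exact (hasCommonNeighbor_of_even T hk cr hpr2 hpq hrq).swap.rotate
    by_cases hqr2 : twistDist T hk q r = 2 * k
    · rw [SimpleGraph.adj_comm] at hpq
      exact (hasCommonNeighbor_of_even T hk cr' hqr2 hpq hrp).rotate.rotate
    -- With no distance equal to 2k, a centre of radius k-1 exists, but its antipode must lie
    -- outside the common cell. The second layer provides room.
    have hj := fin_two_add_one_ne p.2.1
    refine hasCommonNeighbor_off_cells T hk p.1 (p.2.1 + 1) (fun h => hj h.2)
      (fun h => hj (h.2.trans hc.2.symm)) (fun h => hj (h.2.trans cr.2.symm)) (hfr _) ?_ ?_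
    · rw [frameDist_of_eq T hk cr.1]
      rcases dpr with ⟨-, h⟩ | ⟨h, -⟩
      · omega
      · exact absurd cr h
    · rw [frameDist_of_eq T hk cr'.1]
      rcases dqr with ⟨-, h⟩ | ⟨h, -⟩
      · omega
      · exact absurd cr' h
  · have cr' : ¬ (q.1 = r.1 ∧ q.2.1 = r.2.1) := fun h => cr ⟨hc.1.trans h.1, hc.2.trans h.2⟩
    replace dpr : twistDist T hk p r + 1 ≤ 2 * k := by
      rcases dpr with ⟨h, -⟩ | ⟨-, h⟩
      · exact absurd h cr
      · exact h
    replace dqr : twistDist T hk q r + 1 ≤ 2 * k := by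
      rcases dqr with ⟨h, -⟩ | ⟨-, h⟩
      · exact absurd h cr'
      · exact h
    have cs : ¬ (r.1 = p.1 ∧ r.2.1 = p.2.1) := fun h => cr ⟨h.1.symm, h.2.symm⟩
    have cs' : ¬ (r.1 = q.1 ∧ r.2.1 = q.2.1) := fun h => cr' ⟨h.1.symm, h.2.symm⟩
    by_cases hpr2 : twistDist T hk p r + 1 = 2 * k
    · rw [twistDist_comm] at hpr2 dqr
      exact (hasCommonNeighbor_of_odd T hk cs cs' hpr2 dqr (hfr _)).rotate
    by_cases hqr2 : twistDist T hk q r + 1 = 2 * k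
    · rw [twistDist_comm] at hqr2 dpr
      exact (hasCommonNeighbor_of_odd T hk cs' cs hqr2 dpr
        (by rw [frameDist_comm]; exact hfr _)).rotate.swap
    -- Now all distances are at most 2k-2. If `r` occupies the other layer over the same tournament
    -- vertex, both layers are taken and a different tournament vertex is needed.
    by_cases hi : p.1 = r.1
    · obtain ⟨w, hw⟩ := hV p.1
      refine hasCommonNeighbor_off_cells T hk w 0 (fun h => hw h.1)
        (fun h => hw (h.1.trans hc.1.symm)) (fun h => hw (h.1.trans hi.symm)) (hfr _) ?_ ?_
      · rw [frameDist_of_eq T hk hi]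
        omega
      · rw [frameDist_of_eq T hk (hc.1.symm.trans hi)]
        omega
    · have hj := fin_two_add_one_ne p.2.1
      refine hasCommonNeighbor_off_cells T hk p.1 (p.2.1 + 1) (fun h => hj h.2)
        (fun h => hj (h.2.trans hc.2.symm)) (fun h => hi h.1) (hfr _) ?_ ?_
      · change twistDist T hk p r + 2 ≤ 2 * k
        omega
      · rw [frameDist_left_eq T hk hc.1]
        omega

/-- Three pairwise nonadjacent vertices, two of which belong to the same tournament vertex but not
to the same cube, with the third one elsewhere. -/
theorem hasCommonNeighbor_of_two_layers (hi : p.1 = q.1) (hj : p.2.1 ≠ q.2.1) (hr : p.1 ≠ r.1)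
    (hpq : ¬ (twistedGraph T 2 k hk).Adj p q) (hpr : ¬ (twistedGraph T 2 k hk).Adj p r)
    (hqr : ¬ (twistedGraph T 2 k hk).Adj q r) :
    HasCommonNeighbor (twistedGraph T 2 k hk) p q r := by
  have hr' : q.1 ≠ r.1 := fun h => hr (hi.trans h)
  have off : ∀ {a b : V × Fin 2 × (Fin (3 * k - 1) → ZMod 2)},
      ¬ (a.1 = b.1 ∧ a.2.1 = b.2.1) → ¬ (twistedGraph T 2 k hk).Adj a b →
      twistDist T hk a b + 1 ≤ 2 * k := by
    intro a b h h'
    rcases twistDist_of_not_adj T hk h' with ⟨h'', -⟩ | ⟨-, h''⟩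
    · exact absurd h'' h
    · exact h''
  have dpq := off (fun h => hj h.2) hpq
  have dpr := off (fun h => hr h.1) hpr
  have dqr := off (fun h => hr' h.1) hqr
  have f3 : frameDist T hk p.1 q r = twistDist T hk q r := frameDist_left_eq T hk hi r
  have f2 : frameDist T hk q.1 p r = twistDist T hk p r := frameDist_left_eq T hk hi.symm r
  by_cases h12 : twistDist T hk p q + 2 ≤ 2 * k
  · have hfr : ∀ w, frameDist T hk w p q + 2 ≤ 2 * k := fun w => by
      rwa [frameDist_of_eq T hk hi]
    by_cases hpr2 : twistDist T hk p r + 1 = 2 * k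
    · rw [twistDist_comm] at hpr2 dqr
      exact (hasCommonNeighbor_of_odd T hk (fun h => hr h.1.symm) (fun h => hr' h.1.symm)
        hpr2 dqr (hfr _)).rotate
    by_cases hqr2 : twistDist T hk q r + 1 = 2 * k
    · rw [twistDist_comm] at hqr2 dpr
      exact (hasCommonNeighbor_of_odd T hk (fun h => hr' h.1.symm) (fun h => hr h.1.symm) hqr2 dpr
        (by rw [frameDist_comm]; exact hfr _)).rotate.swap
    refine hasCommonNeighbor_off_cells T hk r.1 (r.2.1 + 1) (fun h => hr h.1.symm)
      (fun h => hr' h.1.symm) (fun h => fin_two_add_one_ne _ h.2) (hfr _) ?_ ?_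
    · rw [frameDist_right]
      omega
    · rw [frameDist_right]
      omega
  -- Here d(p, q) = 2k-1. By parity of the perimeter the distances to `r` cannot both be 2k-1, so
  -- the cell of `p` or that of `q` works.
  · obtain ⟨x, -, e⟩ := frameDist_triangle_even T hk p.1 p q r
    change twistDist T hk p q + twistDist T hk p r + _ = _ at e
    rw [f3] at e
    by_cases hqr2 : twistDist T hk q r + 2 ≤ 2 * k
    · exact hasCommonNeighbor_of_odd T hk (fun h => hj h.2) (fun h => hr h.1) (by omega) dpr
        (by rwa [f3])
    · have h : twistDist T hk q p + 1 = 2 * k := by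
        rw [twistDist_comm]
        omega
      exact (hasCommonNeighbor_of_odd T hk (fun h => hj h.2.symm) (fun h => hr' h.1) h dqr
        (by rw [f2]; omega)).swap

/-- In the frame of `p` only the distance from `q` to `r` could be distorted. The cell of `p` serves
if a distance from `p` is 2k-1, and the other layer over `p` otherwise. -/
theorem hasCommonNeighbor_of_frameDist_le (hpq : p.1 ≠ q.1) (hpr : p.1 ≠ r.1)
    (dpq : twistDist T hk p q + 1 ≤ 2 * k) (dpr : twistDist T hk p r + 1 ≤ 2 * k)
    (hqr : frameDist T hk p.1 q r + 2 ≤ 2 * k) :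
    HasCommonNeighbor (twistedGraph T 2 k hk) p q r := by
  by_cases h1 : twistDist T hk p q + 1 = 2 * k
  · exact hasCommonNeighbor_of_odd T hk (fun h => hpq h.1) (fun h => hpr h.1) h1 dpr hqr
  by_cases h2 : twistDist T hk p r + 1 = 2 * k
  · exact (hasCommonNeighbor_of_odd T hk (fun h => hpr h.1) (fun h => hpq h.1) h2 dpq
      (by rwa [frameDist_comm])).rotate.rotate.swap
  · refine hasCommonNeighbor_off_cells T hk p.1 (p.2.1 + 1) (fun h => fin_two_add_one_ne _ h.2)
      (fun h => hpq h.1) (fun h => hpr h.1) ?_ ?_ hqr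
    · change twistDist T hk p q + 2 ≤ 2 * k
      omega
    · change twistDist T hk p r + 2 ≤ 2 * k
      omega

variable {T}

/-- Three pairwise nonadjacent vertices belonging to distinct tournament vertices. -/
theorem hasCommonNeighbor_of_ne (hT : T.IsShattered) (hpq : p.1 ≠ q.1) (hpr : p.1 ≠ r.1)
    (hqr : q.1 ≠ r.1) (npq : ¬ (twistedGraph T 2 k hk).Adj p q)
    (npr : ¬ (twistedGraph T 2 k hk).Adj p r) (nqr : ¬ (twistedGraph T 2 k hk).Adj q r) :
    HasCommonNeighbor (twistedGraph T 2 k hk) p q r := by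
  have off : ∀ {a b : V × Fin 2 × (Fin (3 * k - 1) → ZMod 2)},
      a.1 ≠ b.1 → ¬ (twistedGraph T 2 k hk).Adj a b → twistDist T hk a b + 1 ≤ 2 * k := by
    intro a b h h'
    rcases twistDist_of_not_adj T hk h' with ⟨h'', -⟩ | ⟨-, h''⟩
    · exact absurd h''.1 h
    · exact h''
  have dpq := off hpq npq
  have dpr := off hpr npr
  have dqr := off hqr nqr
  have dqp := dpq
  have drp := dpr
  have drq := dqr
  rw [twistDist_comm] at dqp drp drq
  by_cases h1 : frameDist T hk p.1 q r + 2 ≤ 2 * k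
  · exact hasCommonNeighbor_of_frameDist_le T hk hpq hpr dpq dpr h1
  by_cases h2 : frameDist T hk q.1 r p + 2 ≤ 2 * k
  · exact (hasCommonNeighbor_of_frameDist_le T hk hqr hpq.symm dqr dqp h2).rotate.rotate
  by_cases h3 : frameDist T hk r.1 p q + 2 ≤ 2 * k
  · exact (hasCommonNeighbor_of_frameDist_le T hk hpr.symm hqr.symm drp drq h3).rotate
  obtain ⟨w, wp, wq, wr, ε, hε, e1, e2, e3⟩ := hT.exists_sign hpq hpr hqr
  -- The arguments x, y, -x-y are the angle differences seen from `w`. The adjacency distances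
  -- subtract `ε` from each, the frame of the opposite vertex of the triple adds `2 * ε` instead,
  -- and the frame of `w` adds nothing. For ε = 1, if no opposite frame shortens its side, all three
  -- differences lie in {0, 1}; as they sum to 0 in ℤ/4 they all vanish, and the frame of `w`
  -- shortens every side. The case ε = -1 is symmetric. The first three alternatives contradict
  -- `h3`, `h1` and `h2` respectively.
  have key : ∀ x y ε : ZMod 4, (ε = 1 ∨ ε = -1) →
      cycleNorm (x + 2 * ε) + 1 ≤ cycleNorm (x - ε) ∨
      cycleNorm (y + 2 * ε) + 1 ≤ cycleNorm (y - ε) ∨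
      cycleNorm (-x - y + 2 * ε) + 1 ≤ cycleNorm (-x - y - ε) ∨
      (cycleNorm x + 1 ≤ cycleNorm (x - ε) ∧ cycleNorm y + 1 ≤ cycleNorm (y - ε) ∧
        cycleNorm (-x - y) + 1 ≤ cycleNorm (-x - y - ε)) := by decide
  set α := cubeAngle (show 2 ≤ 3 * k - 1 by omega) p.2.2 + T.sign w p.1 with hα
  set β := cubeAngle (show 2 ≤ 3 * k - 1 by omega) q.2.2 + T.sign w q.1 with hβ
  set γ := cubeAngle (show 2 ≤ 3 * k - 1 by omega) r.2.2 + T.sign w r.1 with hγ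
  have hpa : cubeAngle (show 2 ≤ 3 * k - 1 by omega) p.2.2 = α - T.sign w p.1 := by rw [hα]; ring
  have hqa : cubeAngle (show 2 ≤ 3 * k - 1 by omega) q.2.2 = β - T.sign w q.1 := by rw [hβ]; ring
  have hra : cubeAngle (show 2 ≤ 3 * k - 1 by omega) r.2.2 = γ - T.sign w r.1 := by rw [hγ]; ring
  have fpq : frameDist T hk w p q = cycleNorm (α - β) + tailDist p.2.2 q.2.2 := frameDist_eq ..
  have fqr : frameDist T hk w q r = cycleNorm (β - γ) + tailDist q.2.2 r.2.2 := frameDist_eq ..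
  have frp : frameDist T hk w p r = cycleNorm (-(α - β) - (β - γ)) + tailDist r.2.2 p.2.2 := by
    rw [frameDist_comm, frameDist_eq]
    congr 2
    ring
  have gpq : twistDist T hk p q = cycleNorm (α - β - ε) + tailDist p.2.2 q.2.2 := by
    rw [twistDist, frameDist_eq, T.sign_self, hpa, hqa, e1]
    congr 2
    ring
  have gqr : twistDist T hk q r = cycleNorm (β - γ - ε) + tailDist q.2.2 r.2.2 := by
    rw [twistDist, frameDist_eq, T.sign_self, hqa, hra, e2]
    congr 2
    ring
  have grp : twistDist T hk r p =
      cycleNorm (-(α - β) - (β - γ) - ε) + tailDist r.2.2 p.2.2 := by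
    rw [twistDist, frameDist_eq, T.sign_self, hra, hpa, e3]
    congr 2
    ring
  rw [frameDist_eq, T.sign_swap r.1 p.1, e3, e1, hqa, hra,
    show β - T.sign w q.1 + (ε + T.sign w q.1 - T.sign w p.1) -
      (γ - T.sign w r.1 + -(ε + T.sign w p.1 - T.sign w r.1)) = β - γ + 2 * ε by ring] at h1
  rw [frameDist_eq, T.sign_swap p.1 q.1, e1, e2, hra, hpa,
    show γ - T.sign w r.1 + (ε + T.sign w r.1 - T.sign w q.1) -
      (α - T.sign w p.1 + -(ε + T.sign w q.1 - T.sign w p.1)) =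
        -(α - β) - (β - γ) + 2 * ε by ring] at h2
  rw [frameDist_eq, T.sign_swap q.1 r.1, e2, e3, hpa, hqa,
    show α - T.sign w p.1 + (ε + T.sign w p.1 - T.sign w r.1) -
      (β - T.sign w q.1 + -(ε + T.sign w r.1 - T.sign w q.1)) = α - β + 2 * ε by ring] at h3
  rcases key (α - β) (β - γ) ε hε with h | h | h | ⟨ha, hb, hc⟩
  · omega
  · omega
  · omega
  · exact hasCommonNeighbor_off_cells T hk w 0 (fun h => wp h.1) (fun h => wq h.1)
      (fun h => wr h.1) (by omega) (by omega) (by omega)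

/-- Any three pairwise nonadjacent vertices of `G_T(2, k)` have a common neighbour. -/
theorem hasCommonNeighbor_of_not_adj (hT : T.IsShattered) (hV : ∀ a : V, ∃ b, b ≠ a)
    (npq : ¬ (twistedGraph T 2 k hk).Adj p q)
    (npr : ¬ (twistedGraph T 2 k hk).Adj p r) (nqr : ¬ (twistedGraph T 2 k hk).Adj q r) :
    HasCommonNeighbor (twistedGraph T 2 k hk) p q r := by
  have same : ∀ {p q r : V × Fin 2 × (Fin (3 * k - 1) → ZMod 2)}, p.1 = q.1 →
      ¬ (twistedGraph T 2 k hk).Adj p q → ¬ (twistedGraph T 2 k hk).Adj p r →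
      ¬ (twistedGraph T 2 k hk).Adj q r → HasCommonNeighbor (twistedGraph T 2 k hk) p q r := by
    intro p q r hi hpq hpr hqr
    by_cases hj : p.2.1 = q.2.1
    · exact hasCommonNeighbor_of_same_cell T hk hV ⟨hi, hj⟩ hpq hpr hqr
    by_cases hr : p.1 = r.1
    · have hrp := hpr
      have hrq := hqr
      rw [SimpleGraph.adj_comm] at hrp hrq
      have key : ∀ a b c : Fin 2, a ≠ b → a = c ∨ b = c := by decide
      rcases key _ _ r.2.1 hj with h | h
      · exact (hasCommonNeighbor_of_same_cell T hk hV ⟨hr, h⟩ hpr hpq hrq).swap.rotate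
      · rw [SimpleGraph.adj_comm] at hpq
        exact (hasCommonNeighbor_of_same_cell T hk hV ⟨hi.symm.trans hr, h⟩ hqr hpq
          hrp).rotate.rotate
    · exact hasCommonNeighbor_of_two_layers T hk hi hj hr hpq hpr hqr
  by_cases h1 : p.1 = q.1
  · exact same h1 npq npr nqr
  have nqp := npq
  have nrq := nqr
  have nrp := npr
  rw [SimpleGraph.adj_comm] at nqp nrq nrp
  by_cases h2 : p.1 = r.1
  · exact (same h2 npr npq nrq).swap.rotate
  by_cases h3 : q.1 = r.1
  · exact (same h3 nqr nqp nrp).rotate.rotate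
  · exact hasCommonNeighbor_of_ne hk hT h1 h2 h3 npq npr nqr

end

/-! ### Codegrees, existential completeness and recovery of the tournament -/

section

variable {V : Type*} {T : Tournament V} {k : ℕ} (hk : 1 ≤ k)
  {p q r : V × Fin 2 × (Fin (3 * k - 1) → ZMod 2)}

theorem card_le_ncard_commonNeighbors [Finite V] (w : V) (l : Fin 2)
    (U : Finset (Fin (3 * k - 1) → ZMod 2))
    (hU : ∀ u ∈ U, (twistedGraph T 2 k hk).Adj (w, l, antipode u) p ∧
      (twistedGraph T 2 k hk).Adj (w, l, antipode u) q) :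
    U.card ≤ ((twistedGraph T 2 k hk).commonNeighbors p q).ncard := by
  rw [← Set.ncard_coe_finset]
  refine Set.ncard_le_ncard_of_injOn (fun u => (w, l, antipode u)) ?_ ?_ (Set.toFinite _)
  · intro u hu
    exact ⟨((hU u hu).1).symm, ((hU u hu).2).symm⟩
  · intro u _ u' _ h
    simp only [Prod.mk.injEq, true_and] at h
    exact antipode_injective h

/-- Nonadjacent vertices of `G_T(2, k)` have many common neighbours. -/
theorem centralBinom_le_ncard_commonNeighbors [Finite V] (hV : ∀ a : V, ∃ b, b ≠ a)
    (hpq : ¬ (twistedGraph T 2 k hk).Adj p q) :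
    (k - 1).centralBinom ≤ 2 * ((twistedGraph T 2 k hk).commonNeighbors p q).ncard := by
  have hn := twistDist_of_not_adj T hk hpq
  by_cases hle : twistDist T hk p q + 2 ≤ 2 * k
  · obtain ⟨w, l, cp, cq, hw⟩ : ∃ (w : V) (l : Fin 2), ¬ (w = p.1 ∧ l = p.2.1) ∧
        ¬ (w = q.1 ∧ l = q.2.1) ∧ frameDist T hk w p q = twistDist T hk p q := by
      have hj := fin_two_add_one_ne p.2.1
      by_cases hi : p.1 = q.1
      · obtain ⟨w, hw⟩ := hV p.1
        exact ⟨w, 0, fun h => hw h.1, fun h => hw (h.1.trans hi.symm), frameDist_of_eq T hk hi w⟩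
      · exact ⟨p.1, p.2.1 + 1, fun h => hj h.2, fun h => hi h.1, rfl⟩
    refine (centralBinom_le_card_balls (r := k - 1) (by omega) _ _
      (show frameDist T hk w p q ≤ 2 * (k - 1) by omega)).trans
      (Nat.mul_le_mul_left 2 (card_le_ncard_commonNeighbors hk w l _ fun u hu => ?_))
    obtain ⟨-, h1, h2⟩ := Finset.mem_filter.1 hu
    exact ⟨(adj_antipode_iff ..).2 (Or.inr ⟨cp, by omega⟩),
      (adj_antipode_iff ..).2 (Or.inr ⟨cq, by omega⟩)⟩
  -- The remaining distances are 2k inside one cell and 2k-1 otherwise; there the geodesic points at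
  -- distance k from `p` are counted, with antipodes in the cell of `p`.
  · have hc : (k - 1).centralBinom ≤ (2 * k - 1).choose k := by
      obtain ⟨j, rfl⟩ : ∃ j, k = j + 1 := ⟨k - 1, by omega⟩
      rw [show 2 * (j + 1) - 1 = 2 * j + 1 by omega, Nat.choose_succ_succ, Nat.centralBinom]
      exact Nat.le_add_right _ _
    refine hc.trans (le_trans ?_ (Nat.le_mul_of_pos_left _ two_pos))
    rcases hn with ⟨c, hn⟩ | ⟨c, hn⟩
    · refine le_trans ?_ ((choose_le_card_geodesic _ _ k k
        (show frameDist T hk p.1 p q = k + k by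
          change twistDist T hk p q = k + k
          omega)).trans
        (card_le_ncard_commonNeighbors hk p.1 p.2.1 _ fun u hu => ?_))
      · exact Nat.choose_le_choose k (by omega)
      · obtain ⟨-, h1, h2⟩ := Finset.mem_filter.1 hu
        exact ⟨(adj_antipode_iff ..).2 (Or.inl ⟨⟨rfl, rfl⟩, Or.inl h1⟩),
          (adj_antipode_iff ..).2 (Or.inl ⟨c, Or.inl h2⟩)⟩
    · refine le_trans (le_of_eq ?_) ((choose_le_card_geodesic _ _ k (k - 1)
        (show frameDist T hk p.1 p q = k + (k - 1) by
          change twistDist T hk p q = k + (k - 1)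
          omega)).trans
        (card_le_ncard_commonNeighbors hk p.1 p.2.1 _ fun u hu => ?_))
      · congr 1
        omega
      · obtain ⟨-, h1, h2⟩ := Finset.mem_filter.1 hu
        exact ⟨(adj_antipode_iff ..).2 (Or.inl ⟨⟨rfl, rfl⟩, Or.inl h1⟩),
          (adj_antipode_iff ..).2 (Or.inr ⟨c, by omega⟩)⟩

theorem exists_not_adj_three (hV : ∀ a b c : V, ∃ d, d ≠ a ∧ d ≠ b ∧ d ≠ c)
    (p q r : V × Fin 2 × (Fin (3 * k - 1) → ZMod 2)) :
    ∃ v, v ≠ p ∧ v ≠ q ∧ v ≠ r ∧ ¬ (twistedGraph T 2 k hk).Adj v p ∧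
      ¬ (twistedGraph T 2 k hk).Adj v q ∧ ¬ (twistedGraph T 2 k hk).Adj v r := by
  obtain ⟨w, hp, hq, hr⟩ := hV p.1 q.1 r.1
  obtain ⟨u, h1, h2, h3⟩ := exists_cube_far (k := k) (by omega)
    (cubeRot (show 2 ≤ 3 * k - 1 by omega) (T.sign w p.1) p.2.2)
    (cubeRot (show 2 ≤ 3 * k - 1 by omega) (T.sign w q.1) q.2.2)
    (cubeRot (show 2 ≤ 3 * k - 1 by omega) (T.sign w r.1) r.2.2)
  refine ⟨(w, 0, antipode u), fun h => hp (h ▸ rfl), fun h => hq (h ▸ rfl), fun h => hr (h ▸ rfl),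
    ?_, ?_, ?_⟩ <;> rw [adj_antipode_iff] <;> rintro (⟨c, h⟩ | ⟨-, h⟩)
  · exact hp c.1
  · omega
  · exact hq c.1
  · omega
  · exact hr c.1
  · omega

theorem exists_adj_not_adj_two (hk7 : 7 ≤ k) (hpq : p ≠ q) (hpr : p ≠ r) :
    ∃ v, v ≠ q ∧ v ≠ r ∧ (twistedGraph T 2 k hk).Adj v p ∧
      ¬ (twistedGraph T 2 k hk).Adj v q ∧ ¬ (twistedGraph T 2 k hk).Adj v r := by
  have h0 : cubeRot (show 2 ≤ 3 * k - 1 by omega) (T.sign p.1 p.1) p.2.2 = p.2.2 := by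
    rw [T.sign_self]; rfl
  obtain ⟨u, h1, h2, h3, h2', h3'⟩ := exists_cube_separating (k := k) hk7 (by omega)
    (cubeRot (show 2 ≤ 3 * k - 1 by omega) (T.sign p.1 p.1) p.2.2)
    (cubeRot (show 2 ≤ 3 * k - 1 by omega) (T.sign p.1 q.1) q.2.2)
    (cubeRot (show 2 ≤ 3 * k - 1 by omega) (T.sign p.1 r.1) r.2.2)
  have aux : ∀ {s : V × Fin 2 × (Fin (3 * k - 1) → ZMod 2)}, p ≠ s →
      k ≤ hammingDist u (cubeRot (show 2 ≤ 3 * k - 1 by omega) (T.sign p.1 s.1) s.2.2) →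
      (cubeRot (show 2 ≤ 3 * k - 1 by omega) (T.sign p.1 p.1) p.2.2 ≠
        cubeRot (show 2 ≤ 3 * k - 1 by omega) (T.sign p.1 s.1) s.2.2 →
        k < hammingDist u (cubeRot (show 2 ≤ 3 * k - 1 by omega) (T.sign p.1 s.1) s.2.2) ∧
        hammingDist u (cubeRot (show 2 ≤ 3 * k - 1 by omega) (T.sign p.1 s.1) s.2.2) < 3 * k - 1) →
      (p.1, p.2.1, antipode u) ≠ s ∧
        ¬ (twistedGraph T 2 k hk).Adj (p.1, p.2.1, antipode u) s := by
    intro s hs g g'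
    rw [adj_antipode_iff]
    by_cases hc : p.1 = s.1 ∧ p.2.1 = s.2.1
    · have e : cubeRot (show 2 ≤ 3 * k - 1 by omega) (T.sign p.1 s.1) s.2.2 = s.2.2 := by
        rw [hc.1, T.sign_self]; rfl
      rw [e] at g g' ⊢
      rw [h0] at g'
      obtain ⟨ga, gb⟩ := g' fun h => hs (Prod.ext hc.1 (Prod.ext hc.2 h))
      refine ⟨fun h => ?_, ?_⟩
      · have h' : s.2.2 = antipode u := by rw [← h]
        have := hammingDist_antipode u (antipode u)
        rw [hammingDist_self] at this
        rw [h'] at gb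
        omega
      · rintro (⟨-, h⟩ | ⟨h, -⟩)
        · omega
        · exact h hc
    · refine ⟨fun h => hc (h ▸ ⟨rfl, rfl⟩), ?_⟩
      rintro (⟨h, -⟩ | ⟨-, h⟩)
      · exact hc h
      · omega
  obtain ⟨a1, a2⟩ := aux hpq h2 h2'
  obtain ⟨b1, b2⟩ := aux hpr h3 h3'
  exact ⟨_, a1, b1, (adj_antipode_iff ..).2 (Or.inl ⟨⟨rfl, rfl⟩, Or.inl h1⟩), a2, b2⟩

theorem exists_adj_two_not_adj [Finite V] (hT : T.IsShattered) (hk7 : 7 ≤ k)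
    (hV : ∀ a : V, ∃ b, b ≠ a) (hpq : ¬ (twistedGraph T 2 k hk).Adj p q)
    (hpr : p ≠ r) (hqr : q ≠ r) :
    ∃ v, v ≠ r ∧ (twistedGraph T 2 k hk).Adj v p ∧ (twistedGraph T 2 k hk).Adj v q ∧
      ¬ (twistedGraph T 2 k hk).Adj v r := by
  classical
  have tri : ∀ {a b c}, (twistedGraph T 2 k hk).Adj a b → (twistedGraph T 2 k hk).Adj a c →
      (twistedGraph T 2 k hk).Adj b c → False := fun {a b c} h1 h2 h3 =>
    twistedGraph_cliqueFree T hk {a, b, c} (SimpleGraph.is3Clique_triple_iff.2 ⟨h1, h2, h3⟩)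
  by_cases h : (twistedGraph T 2 k hk).Adj p r ∨ (twistedGraph T 2 k hk).Adj q r
  -- If `r` is adjacent to `p` or `q`, any common neighbour of `p` and `q` other than `r` works,
  -- since a triangle would arise otherwise.
  · have hcard : 1 < ((twistedGraph T 2 k hk).commonNeighbors p q).ncard := by
      have h1 := centralBinom_le_ncard_commonNeighbors hk hV hpq
      have h2 := Nat.centralBinom_strictMono.le_apply (x := k - 1)
      omega
    obtain ⟨v, ⟨hv1, hv2⟩, hv⟩ := Set.exists_ne_of_one_lt_ncard hcard r
    refine ⟨v, hv, hv1.symm, hv2.symm, fun hvr => ?_⟩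
    rcases h with h | h
    · exact tri hv1 h hvr
    · exact tri hv2 h hvr
  · rw [not_or] at h
    -- Otherwise take a neighbour `x` of `r` nonadjacent to `p` and `q`. A common neighbour of `p`,
    -- `q`, `x` cannot be adjacent to `r`, because of the triangle with `x`.
    obtain ⟨x, -, -, hxr, hxp, hxq⟩ := exists_adj_not_adj_two (T := T) hk hk7 hpr.symm hqr.symm
    rw [SimpleGraph.adj_comm] at hxp hxq
    obtain ⟨v, hvp, hvq, hvx⟩ := hasCommonNeighbor_of_not_adj hk hT hV hpq hxp hxq
    refine ⟨v, ?_, hvp, hvq, fun hvr => tri hvx hvr hxr⟩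
    rintro rfl
    exact h.1 hvp.symm

theorem exists_subset_pair {W : Type*} [DecidableEq W] {s : Finset W} {x y : W} (hs : s.card ≤ 2)
    (hx : x ∉ s) (hy : y ≠ x) : ∃ a b, a ≠ x ∧ b ≠ x ∧ s ⊆ {a, b} := by
  obtain h | h | h : s.card = 0 ∨ s.card = 1 ∨ s.card = 2 := by omega
  · rw [Finset.card_eq_zero] at h
    exact ⟨y, y, hy, hy, by simp [h]⟩
  · obtain ⟨a, rfl⟩ := Finset.card_eq_one.1 h
    rw [Finset.mem_singleton] at hx
    exact ⟨a, a, Ne.symm hx, Ne.symm hx, by simp⟩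
  · obtain ⟨a, b, -, rfl⟩ := Finset.card_eq_two.1 h
    simp only [Finset.mem_insert, Finset.mem_singleton, not_or] at hx
    exact ⟨a, b, Ne.symm hx.1, Ne.symm hx.2, subset_rfl⟩

theorem exists_subset_triple {W : Type*} [DecidableEq W] [Nonempty W] {s : Finset W}
    (hs : s.card ≤ 3) : ∃ a b c, s ⊆ {a, b, c} := by
  obtain ⟨x⟩ := ‹Nonempty W›
  obtain h | h | h | h : s.card = 0 ∨ s.card = 1 ∨ s.card = 2 ∨ s.card = 3 := by omega
  · rw [Finset.card_eq_zero] at h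
    exact ⟨x, x, x, by simp [h]⟩
  · obtain ⟨a, rfl⟩ := Finset.card_eq_one.1 h
    exact ⟨a, a, a, by simp⟩
  · obtain ⟨a, b, -, rfl⟩ := Finset.card_eq_two.1 h
    exact ⟨a, a, b, by simp⟩
  · obtain ⟨a, b, c, -, -, -, rfl⟩ := Finset.card_eq_three.1 h
    exact ⟨a, b, c, subset_rfl⟩

theorem twistedGraph_isExistentiallyComplete [Finite V] [Nonempty V] (hT : T.IsShattered)
    (hk7 : 7 ≤ k) (hV : ∀ a b c : V, ∃ d, d ≠ a ∧ d ≠ b ∧ d ≠ c) :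
    IsExistentiallyComplete (twistedGraph T 2 k hk) 3 := by
  classical
  intro A B hBA hA hB
  have hV' : ∀ a : V, ∃ b, b ≠ a := fun a => let ⟨d, h, _⟩ := hV a a a; ⟨d, h⟩
  have hB3 : B.card ≤ 3 := (Finset.card_le_card hBA).trans hA
  have hcard : (A \ B).card + B.card ≤ 3 := by
    rw [Finset.card_sdiff_add_card_eq_card hBA]
    exact hA
  have hne : ∀ x : V × Fin 2 × (Fin (3 * k - 1) → ZMod 2), ∃ y, y ≠ x := fun x =>
    let ⟨d, h⟩ := hV' x.1
    ⟨(d, x.2), fun e => h (congrArg Prod.fst e)⟩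
  obtain h | h | h | h : B.card = 0 ∨ B.card = 1 ∨ B.card = 2 ∨ B.card = 3 := by omega
  · rw [Finset.card_eq_zero] at h
    subst h
    obtain ⟨a, b, c, habc⟩ := exists_subset_triple hA
    obtain ⟨v, va, vb, vc, na, nb, nc⟩ := exists_not_adj_three (T := T) hk hV a b c
    refine ⟨v, fun hv => ?_, by simp, fun x hx _ => ?_⟩
    · have := habc hv
      simp only [Finset.mem_insert, Finset.mem_singleton] at this
      tauto
    · have := habc hx
      simp only [Finset.mem_insert, Finset.mem_singleton] at this
      rcases this with rfl | rfl | rfl <;> assumption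
  · obtain ⟨p, rfl⟩ := Finset.card_eq_one.1 h
    obtain ⟨y, hy⟩ := hne p
    obtain ⟨a, b, ha, hb, hab⟩ := exists_subset_pair (s := A \ {p}) (x := p) (by omega) (by simp) hy
    obtain ⟨v, va, vb, hv, na, nb⟩ := exists_adj_not_adj_two (T := T) hk hk7 ha.symm hb.symm
    refine ⟨v, fun hvA => ?_, by simpa using hv, fun x hx hxp => ?_⟩
    · have := hab (Finset.mem_sdiff.2 ⟨hvA, by simpa using hv.ne⟩)
      simp only [Finset.mem_insert, Finset.mem_singleton] at this
      tauto
    · have := hab (Finset.mem_sdiff.2 ⟨hx, hxp⟩)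
      simp only [Finset.mem_insert, Finset.mem_singleton] at this
      rcases this with rfl | rfl <;> assumption
  · obtain ⟨p, q, hpq, rfl⟩ := Finset.card_eq_two.1 h
    have npq : ¬ (twistedGraph T 2 k hk).Adj p q := hB (by simp) (by simp) hpq
    obtain ⟨r, hrp, hrq, hr⟩ : ∃ r, r ≠ p ∧ r ≠ q ∧ A \ {p, q} ⊆ {r} := by
      obtain h0 | h0 : (A \ {p, q}).card = 0 ∨ (A \ {p, q}).card = 1 := by omega
      · obtain ⟨d, h1, h2, -⟩ := hV p.1 q.1 q.1
        rw [Finset.card_eq_zero] at h0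
        exact ⟨(d, p.2), fun e => h1 (congrArg Prod.fst e), fun e => h2 (congrArg Prod.fst e),
          by simp [h0]⟩
      · obtain ⟨r, hr⟩ := Finset.card_eq_one.1 h0
        have : r ∈ A \ {p, q} := by simp [hr]
        simp only [Finset.mem_sdiff, Finset.mem_insert, Finset.mem_singleton, not_or] at this
        exact ⟨r, this.2.1, this.2.2, hr.subset⟩
    obtain ⟨v, vr, hvp, hvq, hvr⟩ :=
      exists_adj_two_not_adj hk hT hk7 hV' npq hrp.symm hrq.symm
    refine ⟨v, fun hvA => vr ?_, by simp [hvp, hvq], fun x hx hxp => ?_⟩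
    · exact Finset.mem_singleton.1 (hr (Finset.mem_sdiff.2 ⟨hvA, by simp [hvp.ne, hvq.ne]⟩))
    · rwa [Finset.mem_singleton.1 (hr (Finset.mem_sdiff.2 ⟨hx, hxp⟩))]
  · have hAB : B = A := Finset.eq_of_subset_of_card_le hBA (by omega)
    subst hAB
    obtain ⟨p, q, r, hpq, hpr, hqr, rfl⟩ := Finset.card_eq_three.1 h
    obtain ⟨v, hvp, hvq, hvr⟩ := hasCommonNeighbor_of_not_adj hk hT hV'
      (hB (by simp) (by simp) hpq) (hB (by simp) (by simp) hpr) (hB (by simp) (by simp) hqr)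
    refine ⟨v, ?_, by simp [hvp, hvq, hvr], fun x hx hx' => absurd hx hx'⟩
    simp [hvp.ne, hvq.ne, hvr.ne]

theorem Tournament.ext_arc {V : Type*} {T T' : Tournament V}
    (h : ∀ i j, T.arc i j ↔ T'.arc i j) : T = T' := by
  have harc : T.arc = T'.arc := by
    ext i j
    exact h i j
  cases T
  cases T'
  cases harc
  rfl

/-- Seen from `i`, the origin of a cube over `j` is rotated by +1 or -1 according to the arc. The
two images are opposite on the 4-cycle, at distance 2, and a suitable vertex over `i` tells them
apart. -/
theorem twistedGraph_injective {V : Type*} {k m : ℕ} (hk : 1 ≤ k) (hm : 0 < m) :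
    Function.Injective fun T : Tournament V => twistedGraph T m k hk := by
  have key : ∀ {T T' : Tournament V}, twistedGraph T m k hk = twistedGraph T' m k hk →
      ∀ i j, T.arc i j → T'.arc i j := by
    intro T T' h i j hij
    by_contra hn
    have hne : i ≠ j := fun e => T.irrefl j (e ▸ hij)
    have hji : T'.arc j i := (T'.total i j hne).resolve_left hn
    have h2 : 2 ≤ 3 * k - 1 := by omega
    obtain ⟨p₀, p₁, p₂, p₃, hp, e12, -, e23, H⟩ := exists_cube_regions
      (cubeRot h2 1 0) (cubeRot h2 (-1) 0) (cubeRot h2 (-1) 0)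
    have e : hammingDist (cubeRot h2 1 0) (cubeRot h2 (-1) 0) = 2 := by
      rw [hammingDist_cubeRot]
      have : tailDist (0 : Fin (3 * k - 1) → ZMod 2) 0 = 0 := by simp [tailDist]
      rw [this, add_sub_add_left_eq_sub]
      decide
    rw [hammingDist_self] at e23
    -- Flipping only coordinates common to both images gives distance k-1 to the first (adjacent)
    -- and k+1 to the second (nonadjacent).
    obtain ⟨u, hu1, hu2, -⟩ := H (k - 1) 0 0 0 (by omega) (by omega) (by omega) (by omega)
    have a1 : (twistedGraph T m k hk).Adj (i, ⟨0, hm⟩, antipode u) (j, ⟨0, hm⟩, 0) := by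
      refine (adj_antipode_iff ..).2 (Or.inr ⟨fun h => hne h.1, ?_⟩)
      rw [T.sign_of_arc hij]
      change hammingDist u (cubeRot h2 1 0) + 1 ≤ k
      omega
    rw [h, adj_antipode_iff, T'.sign_of_arc' hji] at a1
    rcases a1 with ⟨c, -⟩ | ⟨-, h'⟩
    · exact hne c.1
    · change hammingDist u (cubeRot h2 (-1) 0) + 1 ≤ k at h'
      omega
  intro T T' h
  exact Tournament.ext_arc fun i j => ⟨key h i j, key h.symm i j⟩

end

/-! ### Almost all tournaments are shattered -/

section

variable {V : Type*}

instance [Finite V] : Finite (Tournament V) :=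
  Finite.of_injective (fun T => T.arc) fun _ _ h => Tournament.ext_arc fun i j =>
    iff_of_eq (congrFun (congrFun h i) j)

/-- The set `S` together with `d` carries a copy of `T₄`. -/
def Tournament.CompletesT4 (T : Tournament V) (S : Finset V) (d : V) : Prop :=
  ∃ f : Fin 4 ↪ V, (∀ x, x ∈ Set.range f ↔ x = d ∨ x ∈ S) ∧
    ∀ u v, T.arc (f u) (f v) ↔ T4Arc u v

theorem t4Arc_total : ∀ u v : Fin 4, u ≠ v → T4Arc u v ∨ T4Arc v u := by
  unfold T4Arc; decide

theorem Tournament.completesT4_of_arcs {T : Tournament V} {S : Finset V} {d : V} (f : Fin 4 → V)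
    (hf : ∀ x, x ∈ Set.range f ↔ x = d ∨ x ∈ S) (h : ∀ u v, T4Arc u v → T.arc (f u) (f v)) :
    T.CompletesT4 S d := by
  have hinj : Function.Injective f := by
    intro u v e
    by_contra hne
    rcases t4Arc_total u v hne with h' | h'
    · exact T.irrefl (f v) (e ▸ h u v h')
    · exact T.irrefl (f v) (e ▸ h v u h')
  refine ⟨⟨f, hinj⟩, hf, fun u v => ⟨fun ha => ?_, h u v⟩⟩
  by_contra hn
  have hne : u ≠ v := by
    rintro rfl
    exact T.irrefl _ ha
  exact T.asymm _ _ ha (h v u ((t4Arc_total u v hne).resolve_left hn))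

theorem Tournament.CompletesT4.congr {T T' : Tournament V} {S : Finset V} {d : V}
    (h : ∀ x y, (x = d ∨ x ∈ S) → (y = d ∨ y ∈ S) → (T.arc x y ↔ T'.arc x y))
    (hT : T.CompletesT4 S d) : T'.CompletesT4 S d := by
  obtain ⟨f, hf, ha⟩ := hT
  refine ⟨f, hf, fun u v => ?_⟩
  rw [← h _ _ ((hf _).1 ⟨u, rfl⟩) ((hf _).1 ⟨v, rfl⟩), ha]

/-- Redefine the arcs between `d` and the elements of `S`: the out-neighbours of `d` are those that
satisfy `g`. -/
def Tournament.setArcs (T : Tournament V) {S : Finset V} {d : V} (hd : d ∉ S) (g : V → Prop) :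
    Tournament V where
  arc x y := (x = d ∧ y ∈ S ∧ g y) ∨ (y = d ∧ x ∈ S ∧ ¬ g x) ∨
    (¬ (x = d ∧ y ∈ S) ∧ ¬ (y = d ∧ x ∈ S) ∧ T.arc x y)
  irrefl x := by
    have := T.irrefl x
    rintro (⟨rfl, h, -⟩ | ⟨rfl, h, -⟩ | ⟨-, -, h⟩) <;> contradiction
  asymm x y := by
    have := T.asymm x y
    rintro (⟨rfl, a2, a3⟩ | ⟨rfl, a2, a3⟩ | ⟨a1, a2, a3⟩) (⟨b1, b2, b3⟩ | ⟨b1, b2, b3⟩ | ⟨b1, b2, b3⟩)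
    · exact hd b2
    · exact b3 a3
    · exact b2 ⟨rfl, a2⟩
    · exact a3 b3
    · exact hd b2
    · exact b1 ⟨rfl, a2⟩
    · exact a2 ⟨b1, b2⟩
    · exact a1 ⟨b1, b2⟩
    · exact this a3 b3
  total x y hxy := by
    have := T.total x y hxy
    by_cases c1 : x = d ∧ y ∈ S
    · by_cases h : g y
      · exact Or.inl (Or.inl ⟨c1.1, c1.2, h⟩)
      · exact Or.inr (Or.inr (Or.inl ⟨c1.1, c1.2, h⟩))
    by_cases c2 : y = d ∧ x ∈ S
    · by_cases h : g x
      · exact Or.inr (Or.inl ⟨c2.1, c2.2, h⟩)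
      · exact Or.inl (Or.inr (Or.inl ⟨c2.1, c2.2, h⟩))
    · exact this.imp (fun h => Or.inr (Or.inr ⟨c1, c2, h⟩)) fun h => Or.inr (Or.inr ⟨c2, c1, h⟩)

theorem Tournament.arc_iff_not_arc (T : Tournament V) {x y : V} (h : x ≠ y) :
    T.arc y x ↔ ¬ T.arc x y :=
  ⟨T.asymm y x, (T.total x y h).resolve_left⟩

theorem Tournament.setArcs_arc_of_not (T : Tournament V) {S : Finset V} {d : V} (hd : d ∉ S)
    (g : V → Prop) {x y : V} (h₁ : ¬ (x = d ∧ y ∈ S)) (h₂ : ¬ (y = d ∧ x ∈ S)) :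
    (T.setArcs hd g).arc x y ↔ T.arc x y := by
  constructor
  · rintro (⟨h, h', -⟩ | ⟨h, h', -⟩ | ⟨-, -, h⟩)
    · exact absurd ⟨h, h'⟩ h₁
    · exact absurd ⟨h, h'⟩ h₂
    · exact h
  · exact fun h => Or.inr (Or.inr ⟨h₁, h₂, h⟩)

theorem Tournament.exists_path {T : Tournament V} [DecidableEq V] {S : Finset V} (hS : S.card = 3) :
    ∃ x y z, S = {x, y, z} ∧ T.arc x y ∧ T.arc y z := by
  obtain ⟨a, b, c, hab, hac, hbc, rfl⟩ := Finset.card_eq_three.1 hS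
  rcases T.total a b hab with h1 | h1 <;> rcases T.total a c hac with h2 | h2 <;>
    rcases T.total b c hbc with h3 | h3
  · exact ⟨a, b, c, rfl, h1, h3⟩
  · exact ⟨a, c, b, by ext; simp; tauto, h2, h3⟩
  · exact ⟨a, b, c, rfl, h1, h3⟩
  · exact ⟨c, a, b, by ext; simp; tauto, h2, h1⟩
  · exact ⟨b, a, c, by ext; simp; tauto, h1, h2⟩
  · exact ⟨c, b, a, by ext; simp; tauto, h3, h1⟩
  · exact ⟨b, c, a, by ext; simp; tauto, h3, h2⟩
  · exact ⟨c, b, a, by ext; simp; tauto, h3, h1⟩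

/-- If the triple is cyclic, let `d` dominate it. If it is transitive, its source becomes the vertex
0 of T₄, and `d` closes a cyclic triangle with the other two. -/
theorem Tournament.exists_setArcs_completesT4 [DecidableEq V] (T : Tournament V) {S : Finset V}
    {d : V} (hS : S.card = 3) (hd : d ∉ S) : ∃ g, (T.setArcs hd g).CompletesT4 S d := by
  obtain ⟨x, y, z, rfl, hxy, hyz⟩ := T.exists_path hS
  have hxy' : x ≠ y := fun h => T.irrefl y (h ▸ hxy)
  have hyz' : y ≠ z := fun h => T.irrefl z (h ▸ hyz)
  have hxz' : x ≠ z := fun h => T.asymm _ _ hxy (h ▸ hyz)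
  have hd' := hd
  simp only [Finset.mem_insert, Finset.mem_singleton, not_or] at hd'
  obtain ⟨dx, dy, dz⟩ := hd'
  rcases T.total x z hxz' with hxz | hzx
  · refine ⟨fun v => v = y, completesT4_of_arcs ![x, y, z, d] ?_ ?_⟩
    · intro v
      simp [eq_comm]
      tauto
    · intro u v huv
      simp only [T4Arc, Finset.mem_insert, Prod.mk.injEq, Finset.mem_singleton] at huv
      rcases huv with ⟨rfl, rfl⟩ | ⟨rfl, rfl⟩ | ⟨rfl, rfl⟩ | ⟨rfl, rfl⟩ | ⟨rfl, rfl⟩ | ⟨rfl, rfl⟩ <;>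
        simp [setArcs, *, Ne.symm, eq_comm]
  · refine ⟨fun v => True, completesT4_of_arcs ![d, x, y, z] ?_ ?_⟩
    · intro v
      simp [eq_comm]
      tauto
    · intro u v huv
      simp only [T4Arc, Finset.mem_insert, Prod.mk.injEq, Finset.mem_singleton] at huv
      rcases huv with ⟨rfl, rfl⟩ | ⟨rfl, rfl⟩ | ⟨rfl, rfl⟩ | ⟨rfl, rfl⟩ | ⟨rfl, rfl⟩ | ⟨rfl, rfl⟩ <;>
        simp [setArcs, *, Ne.symm, eq_comm]

open Classical in
-- Given failure on `D`, the vertex `d` succeeds with probability at least 1/8: one of the 8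
-- patterns between `d` and `S` completes T₄, and changing these arcs affects nothing that concerns
-- `D`.
theorem card_not_completesT4_insert [Fintype (Tournament V)] {S D : Finset V}
    {d : V} (hS : S.card = 3) (hd : d ∉ S) (hdD : d ∉ D) :
    8 * (Finset.univ.filter fun T : Tournament V =>
        ∀ x ∈ insert d D, ¬ T.CompletesT4 S x).card ≤
      7 * (Finset.univ.filter fun T : Tournament V => ∀ x ∈ D, ¬ T.CompletesT4 S x).card := by
  set A := Finset.univ.filter fun T : Tournament V => ∀ x ∈ D, ¬ T.CompletesT4 S x with hA
  have h1 : (Finset.univ.filter fun T : Tournament V =>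
      ∀ x ∈ insert d D, ¬ T.CompletesT4 S x) = A.filter fun T => ¬ T.CompletesT4 S d := by
    ext T
    simp only [hA, Finset.mem_filter, Finset.mem_univ, true_and, Finset.mem_insert,
      forall_eq_or_imp]
    tauto
  have h2 := Finset.card_filter_add_card_filter_not (s := A) fun T => T.CompletesT4 S d
  choose g hg using fun T : Tournament V => T.exists_setArcs_completesT4 hS hd
  have h3 : A.card ≤ 8 * (A.filter fun T => T.CompletesT4 S d).card := by
    refine Finset.card_le_mul_card_image_of_maps_to (f := fun T => T.setArcs hd (g T)) ?_ 8 ?_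
    · intro T hT
      refine Finset.mem_filter.2 ⟨?_, hg T⟩
      simp only [hA, Finset.mem_filter, Finset.mem_univ, true_and] at hT ⊢
      intro x hx hc
      refine hT x hx (hc.congr fun a b ha hb => ?_)
      have had : a ≠ d := by
        rintro rfl
        rcases ha with rfl | ha
        · exact hdD hx
        · exact hd ha
      have hbd : b ≠ d := by
        rintro rfl
        rcases hb with rfl | hb
        · exact hdD hx
        · exact hd hb
      exact T.setArcs_arc_of_not hd _ (fun h => had h.1) fun h => hbd h.1
    · intro T' _
      -- A fibre of the modification is determined by the three overwritten arcs.
      have h8 : Fintype.card (S → Prop) = 8 := by simp [hS]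
      rw [← h8, ← Finset.card_univ]
      refine Finset.card_le_card_of_injOn (fun T s => T.arc d s) (fun _ _ => Finset.mem_univ _) ?_
      intro T hT T'' hT'' h
      simp only [Finset.coe_filter, Set.mem_ofPred_eq] at hT hT''
      have hds : ∀ s ∈ S, (T.arc d s ↔ T''.arc d s) := fun s hs =>
        iff_of_eq (congrFun h ⟨s, hs⟩)
      have hds' : ∀ s ∈ S, (T.arc s d ↔ T''.arc s d) := by
        intro s hs
        have hne : d ≠ s := fun e => hd (e ▸ hs)
        rw [T.arc_iff_not_arc hne, T''.arc_iff_not_arc hne, hds s hs]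
      refine Tournament.ext_arc fun x y => ?_
      by_cases c1 : x = d ∧ y ∈ S
      · rw [c1.1]
        exact hds y c1.2
      by_cases c2 : y = d ∧ x ∈ S
      · rw [c2.1]
        exact hds' x c2.2
      rw [← T.setArcs_arc_of_not hd (g T) c1 c2, hT.2, ← hT''.2,
        T''.setArcs_arc_of_not hd (g T'') c1 c2]
  rw [h1]
  omega

open Classical in
theorem card_not_completesT4 [Fintype (Tournament V)] {S D : Finset V}
    (hS : S.card = 3) (hDS : Disjoint D S) :
    8 ^ D.card * (Finset.univ.filter fun T : Tournament V =>
        ∀ x ∈ D, ¬ T.CompletesT4 S x).card ≤ 7 ^ D.card * Fintype.card (Tournament V) := by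
  induction D using Finset.induction_on with
  | empty => simp
  | insert d D hd ih =>
    rw [Finset.disjoint_insert_left] at hDS
    have h1 := card_not_completesT4_insert hS hDS.1 hd
    have h2 := ih hDS.2
    rw [Finset.card_insert_of_notMem hd]
    calc 8 ^ (D.card + 1) * (Finset.univ.filter fun T : Tournament V =>
            ∀ x ∈ insert d D, ¬ T.CompletesT4 S x).card
        = 8 ^ D.card * (8 * (Finset.univ.filter fun T : Tournament V =>
            ∀ x ∈ insert d D, ¬ T.CompletesT4 S x).card) := by ring
      _ ≤ 8 ^ D.card * (7 * (Finset.univ.filter fun T : Tournament V =>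
            ∀ x ∈ D, ¬ T.CompletesT4 S x).card) := Nat.mul_le_mul_left _ h1
      _ = 7 * (8 ^ D.card * (Finset.univ.filter fun T : Tournament V =>
            ∀ x ∈ D, ¬ T.CompletesT4 S x).card) := by ring
      _ ≤ 7 * (7 ^ D.card * Fintype.card (Tournament V)) := Nat.mul_le_mul_left _ h2
      _ = 7 ^ (D.card + 1) * Fintype.card (Tournament V) := by ring

open Classical in
-- Union bound over the triples; copies of the reversed T₄ are not needed.
theorem card_not_isShattered [Fintype V] [Fintype (Tournament V)] :
    8 ^ (Fintype.card V - 3) * (Finset.univ.filter fun T : Tournament V => ¬ T.IsShattered).card ≤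
      (Fintype.card V).choose 3 * (7 ^ (Fintype.card V - 3) * Fintype.card (Tournament V)) := by
  have hsub : (Finset.univ.filter fun T : Tournament V => ¬ T.IsShattered) ⊆
      (Finset.univ.powersetCard 3).biUnion fun S : Finset V =>
        Finset.univ.filter fun T : Tournament V =>
          ∀ x ∈ Finset.univ \ S, ¬ T.CompletesT4 S x := by
    intro T hT
    have hT' := (Finset.mem_filter.1 hT).2
    simp only [Tournament.IsShattered, not_forall] at hT'
    obtain ⟨a, b, c, hab, hac, hbc, h⟩ := hT'
    simp only [Finset.mem_biUnion, Finset.mem_powersetCard_univ, Finset.mem_filter,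
      Finset.mem_univ, true_and]
    refine ⟨{a, b, c}, Finset.card_eq_three.2 ⟨a, b, c, hab, hac, hbc, rfl⟩, fun x _ hc => h ?_⟩
    obtain ⟨f, hf, harc⟩ := hc
    exact ⟨f, (hf a).2 (by simp), (hf b).2 (by simp), (hf c).2 (by simp), Or.inl harc⟩
  have hle := (Finset.card_le_card hsub).trans Finset.card_biUnion_le
  refine (Nat.mul_le_mul_left _ hle).trans ?_
  rw [Finset.mul_sum, ← Finset.card_univ (α := V), ← Finset.card_powersetCard, ← smul_eq_mul]
  refine Finset.sum_le_card_nsmul _ _ _ fun S hS => ?_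
  have hS3 := (Finset.mem_powersetCard.1 hS).2
  have := card_not_completesT4 hS3 (Finset.sdiff_disjoint (s := S) (t := Finset.univ))
  rw [Finset.card_sdiff_of_subset (Finset.subset_univ S), hS3] at this
  refine le_of_eq_of_le ?_ this
  congr!

/-- The tournament on `Fin t` in which the arcs between `{0, …, h - 1}` and `{h, …, 2h - 1}` are
prescribed by `S`. -/
def bipartiteTournament (t h : ℕ) (S : Finset (Fin h × Fin h)) : Tournament (Fin t) where
  arc i j := (i < j ∧ ∃ p ∈ S, i.val = p.1.val ∧ j.val = h + p.2.val) ∨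
    (j < i ∧ ¬ ∃ p ∈ S, j.val = p.1.val ∧ i.val = h + p.2.val)
  irrefl i := by simp
  asymm i j := by
    rintro (⟨h1, h2⟩ | ⟨h1, h2⟩) (⟨h3, h4⟩ | ⟨h3, h4⟩)
    · exact absurd h1 h3.asymm
    · exact h4 h2
    · exact h2 h4
    · exact absurd h1 h3.asymm
  total i j hij := by
    rcases lt_or_gt_of_ne hij with h1 | h1
    · simp only [h1, h1.asymm, true_and, false_and, or_false, false_or]
      exact em _
    · simp only [h1, h1.asymm, true_and, false_and, or_false, false_or]
      exact (em _).symm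

theorem two_pow_le_card_tournament (t h : ℕ) (hht : 2 * h ≤ t) [Fintype (Tournament (Fin t))] :
    2 ^ (h * h) ≤ Fintype.card (Tournament (Fin t)) := by
  have h1 : Fintype.card (Finset (Fin h × Fin h)) = 2 ^ (h * h) := by simp
  rw [← h1]
  refine Fintype.card_le_of_injective (bipartiteTournament t h) fun S S' e => ?_
  have key : ∀ (S : Finset (Fin h × Fin h)) (a b : Fin h),
      (bipartiteTournament t h S).arc ⟨a, by omega⟩ ⟨h + b, by omega⟩ ↔ (a, b) ∈ S := by
    intro S a b
    have hlt : ¬ (h + b.val < a.val) := by omega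
    have hlt' : a.val < h + b.val := by omega
    simp only [bipartiteTournament, Fin.mk_lt_mk, hlt, hlt', true_and, false_and, or_false]
    constructor
    · rintro ⟨⟨a', b'⟩, hp, h1, h2⟩
      have ha : a = a' := Fin.ext h1
      have hb : b = b' := Fin.ext (by simpa using h2)
      rwa [ha, hb]
    · exact fun hp => ⟨(a, b), hp, rfl, rfl⟩
  ext ⟨a, b⟩
  rw [← key S, ← key S', e]

end

open Classical in
/-- Almost all tournaments are shattered. -/
theorem eventually_two_pow_le_card_isShattered : ∀ᶠ t : ℕ in Filter.atTop,
    ∀ [Fintype (Tournament (Fin t))], 2 ^ ((t / 2) * (t / 2)) ≤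
      2 * (Finset.univ.filter fun T : Tournament (Fin t) => T.IsShattered).card := by
  have hlim := tendsto_pow_const_mul_const_pow_of_lt_one 3 (r := (7 / 8 : ℝ)) (by norm_num)
    (by norm_num)
  -- The threshold is chosen so that t³(7/8)^(t-3) < 1/2, which makes at most half of the
  -- tournaments fail.
  have hev := hlim.eventually (gt_mem_nhds (show (0 : ℝ) < (7 / 8) ^ 3 / 2 by norm_num))
  filter_upwards [hev, Filter.eventually_ge_atTop 3] with t ht ht3 inst
  have h1 := card_not_isShattered (V := Fin t)
  rw [Fintype.card_fin] at h1
  have h2 := two_pow_le_card_tournament t (t / 2) (by omega)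
  have h3 := Finset.card_filter_add_card_filter_not (s := Finset.univ)
    fun T : Tournament (Fin t) => T.IsShattered
  rw [Finset.card_univ] at h3
  have hpow : 2 * (t.choose 3 * 7 ^ (t - 3)) ≤ 8 ^ (t - 3) := by
    have hc : ((t.choose 3 : ℕ) : ℝ) ≤ (t : ℝ) ^ 3 := by exact_mod_cast Nat.choose_le_pow t 3
    obtain ⟨s, rfl⟩ : ∃ s, t = s + 3 := ⟨t - 3, by omega⟩
    have h7 : (((s + 3 : ℕ) : ℝ)) ^ 3 * (7 / 8) ^ s < 1 / 2 := by
      rw [pow_add, ← mul_assoc] at ht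
      have : (0 : ℝ) < (7 / 8) ^ 3 := by norm_num
      refine lt_of_mul_lt_mul_right (ht.trans_le ?_) this.le
      linarith
    have h8 : (2 * ((s + 3).choose 3 * 7 ^ s) : ℝ) ≤ 8 ^ s := by
      rw [div_pow, ← mul_div_assoc, div_lt_iff₀ (by positivity)] at h7
      have := mul_le_mul_of_nonneg_right hc (show (0 : ℝ) ≤ 7 ^ s by positivity)
      linarith
    rw [Nat.add_sub_cancel]
    exact_mod_cast h8
  set N := Fintype.card (Tournament (Fin t))
  set B := (Finset.univ.filter fun T : Tournament (Fin t) => ¬ T.IsShattered).card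
  have h4 : 8 ^ (t - 3) * (2 * B) ≤ 8 ^ (t - 3) * N := by
    calc 8 ^ (t - 3) * (2 * B) = 2 * (8 ^ (t - 3) * B) := by ring
      _ ≤ 2 * (t.choose 3 * (7 ^ (t - 3) * N)) := Nat.mul_le_mul_left _ h1
      _ = 2 * (t.choose 3 * 7 ^ (t - 3)) * N := by ring
      _ ≤ 8 ^ (t - 3) * N := Nat.mul_le_mul_right _ hpow
  have h5 := Nat.le_of_mul_le_mul_left h4 (by positivity)
  omega

/-! ### Isomorphism invariance and passage to isomorphism classes -/

theorem IsExistentiallyComplete.of_iso {W W' : Type*} {G : SimpleGraph W} {H : SimpleGraph W'}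
    {m : ℕ} (φ : H ≃g G) (hG : IsExistentiallyComplete G m) : IsExistentiallyComplete H m := by
  intro A B hBA hA hB
  obtain ⟨v, hv, hvB, hvA⟩ := hG (A.map φ.toEquiv.toEmbedding) (B.map φ.toEquiv.toEmbedding)
    (Finset.map_subset_map.2 hBA) (by rwa [Finset.card_map]) (by
      intro x hx y hy hxy
      simp only [Finset.coe_map, Set.mem_image, Finset.mem_coe] at hx hy
      obtain ⟨a, ha, rfl⟩ := hx
      obtain ⟨b, hb, rfl⟩ := hy
      exact fun hab => hB ha hb (fun e => hxy (e ▸ rfl)) (φ.map_adj_iff.1 hab))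
  refine ⟨φ.symm v, fun h => hv ?_, fun b hb => ?_, fun a ha haB hab => ?_⟩
  · exact Finset.mem_map.2 ⟨_, h, φ.apply_symm_apply v⟩
  · have := hvB (φ b) (Finset.mem_map.2 ⟨b, hb, rfl⟩)
    rwa [← φ.map_adj_iff, φ.apply_symm_apply]
  · refine hvA (φ a) (Finset.mem_map.2 ⟨a, ha, rfl⟩) (fun h => haB ?_) ?_
    · obtain ⟨b, hb, e⟩ := Finset.mem_map.1 h
      rwa [← φ.injective e]
    · rwa [← φ.map_adj_iff, φ.apply_symm_apply] at hab

theorem Is3ECTF.of_iso {W W' : Type*} {G : SimpleGraph W} {H : SimpleGraph W'} (φ : H ≃g G)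
    (hG : Is3ECTF G) : Is3ECTF H := by
  obtain ⟨h1, h2, h3⟩ := hG
  exact ⟨Finite.of_equiv W φ.symm.toEquiv, h2.comap ⟨φ.toEmbedding.toCopy⟩, h3.of_iso φ⟩

theorem ncard_commonNeighbors_of_iso {W W' : Type*} [Finite W'] {G : SimpleGraph W}
    {H : SimpleGraph W'} (φ : H ≃g G) (x y : W') :
    (G.commonNeighbors (φ x) (φ y)).ncard = (H.commonNeighbors x y).ncard := by
  rw [← Set.ncard_image_of_injective (H.commonNeighbors x y) φ.injective]
  congr 1
  ext v
  constructor
  · rintro ⟨h1, h2⟩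
    refine ⟨φ.symm v, ⟨?_, ?_⟩, φ.apply_symm_apply v⟩
    · change H.Adj _ _
      rw [← φ.map_adj_iff, φ.apply_symm_apply]
      exact h1
    · change H.Adj _ _
      rw [← φ.map_adj_iff, φ.apply_symm_apply]
      exact h2
  · rintro ⟨u, ⟨h1, h2⟩, rfl⟩
    exact ⟨φ.map_adj_iff.2 h1, φ.map_adj_iff.2 h2⟩

open Classical in
/-- A family of labelled graphs on `N` vertices contains pairwise nonisomorphic members, at least
one for every `N!` members of the family. -/
theorem exists_pairwise_not_iso {N : ℕ} (X : Finset (SimpleGraph (Fin N))) :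
    ∃ S ⊆ X, (∀ G ∈ S, ∀ H ∈ S, G ≠ H → IsEmpty (G ≃g H)) ∧ X.card ≤ N.factorial * S.card := by
  let r : Setoid (SimpleGraph (Fin N)) :=
    ⟨fun G H => Nonempty (G ≃g H), fun G => ⟨SimpleGraph.Iso.refl⟩, fun ⟨φ⟩ => ⟨φ.symm⟩,
      fun ⟨φ⟩ ⟨ψ⟩ => ⟨φ.trans ψ⟩⟩
  have hsel : ∀ b ∈ X.image (Quotient.mk r), ∃ G ∈ X, Quotient.mk r G = b := fun b hb =>
    Finset.mem_image.1 hb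
  choose! sel hselX hsel using hsel
  have hinj : Set.InjOn sel (X.image (Quotient.mk r)) := fun b hb b' hb' h => by
    rw [← hsel b hb, ← hsel b' hb', h]
  refine ⟨(X.image (Quotient.mk r)).image sel, ?_, ?_, ?_⟩
  · intro G hG
    obtain ⟨b, hb, rfl⟩ := Finset.mem_image.1 hG
    exact hselX b hb
  · intro G hG H hH hne
    obtain ⟨b, hb, rfl⟩ := Finset.mem_image.1 hG
    obtain ⟨b', hb', rfl⟩ := Finset.mem_image.1 hH
    refine ⟨fun φ => hne ?_⟩
    have : Quotient.mk r (sel b) = Quotient.mk r (sel b') := Quotient.sound ⟨φ⟩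
    rw [hsel b hb, hsel b' hb'] at this
    rw [this]
  · rw [Finset.card_image_of_injOn hinj]
    refine Finset.card_le_mul_card_image X _ fun b hb => ?_
    obtain ⟨G₀, -, rfl⟩ := Finset.mem_image.1 hb
    have hsub : (X.filter fun G => Quotient.mk r G = Quotient.mk r G₀) ⊆
        Finset.univ.image fun σ : Equiv.Perm (Fin N) => G₀.comap σ := by
      intro G hG
      obtain ⟨φ⟩ : r.r G G₀ := Quotient.exact (Finset.mem_filter.1 hG).2
      refine Finset.mem_image.2 ⟨φ.toEquiv, Finset.mem_univ _, ?_⟩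
      ext x y
      exact φ.map_adj_iff
    refine (Finset.card_le_card hsub).trans (Finset.card_image_le.trans ?_)
    rw [Finset.card_univ, Fintype.card_perm, Fintype.card_fin]

open Classical in
theorem exists_nonisomorphic_twistedGraphs {k t : ℕ} (hk : 1 ≤ k)
    [Fintype (Tournament (Fin t))] :
    ∃ S : Finset (SimpleGraph (Fin (t * 2 ^ (3 * k)))),
      (Finset.univ.filter fun T : Tournament (Fin t) => T.IsShattered).card ≤
        (t * 2 ^ (3 * k)).factorial * S.card ∧
      (∀ G ∈ S, ∀ H ∈ S, G ≠ H → IsEmpty (G ≃g H)) ∧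
      ∀ G ∈ S, ∃ T : Tournament (Fin t), T.IsShattered ∧ Nonempty (G ≃g twistedGraph T 2 k hk) := by
  have hcard : Fintype.card (Fin t × Fin 2 × (Fin (3 * k - 1) → ZMod 2)) = t * 2 ^ (3 * k) := by
    simp only [Fintype.card_prod, Fintype.card_fin, Fintype.card_fun, ZMod.card]
    rw [← pow_succ', show 3 * k - 1 + 1 = 3 * k by omega]
  let e := Fintype.equivFinOfCardEq hcard
  have hinj : Function.Injective fun T : Tournament (Fin t) =>
      (twistedGraph T 2 k hk).comap e.symm := by
    intro T T' h
    refine twistedGraph_injective hk two_pos ?_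
    ext x y
    have := congrArg (fun G : SimpleGraph _ => G.Adj (e x) (e y)) h
    simpa using this
  obtain ⟨S, hSX, hS, hcardS⟩ := exists_pairwise_not_iso
    ((Finset.univ.filter fun T : Tournament (Fin t) => T.IsShattered).image
      fun T : Tournament (Fin t) => (twistedGraph T 2 k hk).comap e.symm)
  rw [Finset.card_image_of_injective _ hinj] at hcardS
  refine ⟨S, hcardS, hS, fun G hG => ?_⟩
  obtain ⟨T, hT, rfl⟩ := Finset.mem_image.1 (hSX hG)
  exact ⟨T, (Finset.mem_filter.1 hT).2, ⟨SimpleGraph.Iso.comap e.symm _⟩⟩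

theorem twistedGraph_is3ECTF {t k : ℕ} (ht : 4 ≤ t) (hk : 1 ≤ k) (hk7 : 7 ≤ k)
    {T : Tournament (Fin t)} (hT : T.IsShattered) : Is3ECTF (twistedGraph T 2 k hk) := by
  have : Nonempty (Fin t) := ⟨⟨0, by omega⟩⟩
  refine ⟨inferInstance, twistedGraph_cliqueFree T hk,
    twistedGraph_isExistentiallyComplete hk hT hk7 fun a b c => ?_⟩
  have hlt : ({a, b, c} : Finset (Fin t)).card < (Finset.univ : Finset (Fin t)).card := by
    rw [Finset.card_univ, Fintype.card_fin]
    exact lt_of_le_of_lt Finset.card_le_three (by omega)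
  obtain ⟨d, -, hd⟩ := Finset.exists_mem_notMem_of_card_lt_card hlt
  simp only [Finset.mem_insert, Finset.mem_singleton, not_or] at hd
  exact ⟨d, hd⟩

/-! ### Choice of the dimension and final estimates -/

/-- Take the least j whose central binomial coefficient reaches 2M; the factor 2 is the one lost in
the codegree bound. With i = j - 1, minimality gives 4^i ≤ 4iM, hence 2^i ≤ 4M ≤ M³ and i = O(log
M). The constant 4^7 also covers small j, where k = 7. -/
theorem exists_dimension (M : ℕ) (hM : 2 ≤ M) : ∃ k, 7 ≤ k ∧ 2 * M ≤ (k - 1).centralBinom ∧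
    (4 : ℝ) ^ k ≤ 4 ^ 7 * (M * Real.log M) := by
  have hM' : (2 : ℝ) ≤ M := by exact_mod_cast hM
  have hlog2 : 0.69 < Real.log 2 := lt_trans (by norm_num) Real.log_two_gt_d9
  have hlogM : Real.log 2 ≤ Real.log M := Real.log_le_log two_pos hM'
  have hex : ∃ j : ℕ, 2 * M ≤ j.centralBinom :=
    ⟨2 * M, Nat.centralBinom_strictMono.le_apply⟩
  classical
  set j := Nat.find hex with hj
  have hjs : 2 * M ≤ j.centralBinom := Nat.find_spec hex
  rcases le_or_gt j 6 with hj6 | hj6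
  · refine ⟨7, le_rfl, hjs.trans (Nat.centralBinom_strictMono.monotone hj6), ?_⟩
    have : 1 ≤ (M : ℝ) * Real.log M := by nlinarith
    linarith
  · obtain ⟨i, hi⟩ : ∃ i, j = i + 1 := ⟨j - 1, by omega⟩
    refine ⟨j + 1, by omega, by simpa using hjs, ?_⟩
    have hlt : i.centralBinom < 2 * M := by
      have := Nat.find_min hex (m := i) (by omega)
      omega
    have h4 := Nat.four_pow_le_two_mul_self_mul_centralBinom i (by omega)
    have h4' : (4 : ℝ) ^ i ≤ 4 * i * M := by
      have : 4 ^ i ≤ 4 * i * M := by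
        calc 4 ^ i ≤ 2 * i * i.centralBinom := h4
          _ ≤ 2 * i * (2 * M) := Nat.mul_le_mul_left _ hlt.le
          _ = 4 * i * M := by ring
      exact_mod_cast this
    have h2 : (2 : ℝ) ^ i ≤ 4 * M := by
      have hi2 : (i : ℝ) ≤ 2 ^ i := by exact_mod_cast i.lt_two_pow_self.le
      have hpos : (0 : ℝ) < 2 ^ i := by positivity
      have e : (4 : ℝ) ^ i = 2 ^ i * 2 ^ i := by rw [← mul_pow]; norm_num
      have : (2 : ℝ) ^ i * 2 ^ i ≤ 4 * M * 2 ^ i := by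
        rw [← e]
        nlinarith
      exact le_of_mul_le_mul_right this hpos
    have hilog : (i : ℝ) * Real.log 2 ≤ 3 * Real.log M := by
      have := Real.log_le_log (by positivity) h2
      rw [Real.log_pow, Real.log_mul (by norm_num) (by positivity),
        show (4 : ℝ) = 2 ^ 2 by norm_num, Real.log_pow] at this
      push_cast at this
      linarith
    have hi5 : (i : ℝ) ≤ 5 * Real.log M := by nlinarith
    rw [hi, pow_add, pow_add]
    nlinarith [mul_le_mul_of_nonneg_left hi5 (show (0 : ℝ) ≤ 4 * M by positivity)]

theorem eventually_factorial_mul_le (A : ℕ) (hA : 0 < A) : ∀ᶠ t : ℕ in Filter.atTop,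
    2 * ((t * A).factorial : ℝ) * (2 : ℝ) ^ ((t : ℝ) ^ 2 / 16) ≤
      (2 : ℝ) ^ ((t / 2) * (t / 2)) := by
  have hA' : (0 : ℝ) < A := by exact_mod_cast hA
  have hlog2 : 0 < Real.log 2 := Real.log_pos one_lt_two
  have hlim : Filter.Tendsto (fun t : ℕ => (t : ℝ) * A) Filter.atTop Filter.atTop :=
    tendsto_natCast_atTop_atTop.atTop_mul_const hA'
  have hev := hlim.eventually (Real.isLittleO_log_id_atTop.bound
    (show 0 < Real.log 2 / (16 * A ^ 2) by positivity))
  -- From t = 6 on, ((t-1)/2)² ≥ 1 + t²/8, which absorbs the factor 2, the factorial and the target,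
  -- the last two being at most 2^(t²/16) each.
  filter_upwards [hev, Filter.eventually_ge_atTop 6] with t ht ht6
  have ht6' : (6 : ℝ) ≤ t := by exact_mod_cast ht6
  have htA : (0 : ℝ) < t * A := by positivity
  have hfac : ((t * A).factorial : ℝ) ≤ (2 : ℝ) ^ ((t : ℝ) ^ 2 / 16) := by
    have h1 : ((t * A).factorial : ℝ) ≤ ((t : ℝ) * A) ^ (t * A) := by
      exact_mod_cast Nat.factorial_le_pow (t * A)
    refine h1.trans ?_
    rw [← Real.exp_log (pow_pos htA (t * A)), Real.rpow_def_of_pos two_pos, Real.log_pow]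
    refine Real.exp_le_exp.2 ?_
    have h2 : Real.log (t * A) ≤ Real.log 2 / (16 * A ^ 2) * (t * A) := by
      refine (le_abs_self _).trans ?_
      simpa [abs_of_pos htA] using ht
    push_cast
    calc (t : ℝ) * A * Real.log (t * A) ≤ t * A * (Real.log 2 / (16 * A ^ 2) * (t * A)) :=
          mul_le_mul_of_nonneg_left h2 htA.le
      _ = Real.log 2 * ((t : ℝ) ^ 2 / 16) := by
          field_simp
  calc 2 * ((t * A).factorial : ℝ) * (2 : ℝ) ^ ((t : ℝ) ^ 2 / 16)
      ≤ 2 * (2 : ℝ) ^ ((t : ℝ) ^ 2 / 16) * (2 : ℝ) ^ ((t : ℝ) ^ 2 / 16) := by gcongr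
    _ = (2 : ℝ) ^ (1 + (t : ℝ) ^ 2 / 16 + (t : ℝ) ^ 2 / 16) := by
        rw [Real.rpow_add two_pos, Real.rpow_add two_pos, Real.rpow_one]
    _ ≤ (2 : ℝ) ^ ((((t / 2) * (t / 2) : ℕ)) : ℝ) := by
        refine Real.rpow_le_rpow_of_exponent_le one_le_two ?_
        have h3 : ((t : ℝ) - 1) / 2 ≤ ((t / 2 : ℕ) : ℝ) := by
          have : t ≤ 2 * (t / 2) + 1 := by omega
          have : (t : ℝ) ≤ 2 * ((t / 2 : ℕ) : ℝ) + 1 := by exact_mod_cast this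
          linarith
        have h4 := mul_le_mul h3 h3 (by linarith) (by positivity)
        push_cast at h4 ⊢
        nlinarith
    _ = (2 : ℝ) ^ ((t / 2) * (t / 2)) := Real.rpow_natCast _ _

theorem mainTheorem6 :
    ∃ c : ℝ, 0 < c ∧ ∀ μ : ℕ, ∃ (k : ℕ) (hk : 1 ≤ k) (n₀ : ℕ), ∀ n : ℕ, n₀ ≤ n →
      ∃ S : Finset (Σ v : ℕ, SimpleGraph (Fin v)),
        (2 : ℝ) ^ (c * (n : ℝ) ^ 2 /
          (((max μ 2 : ℕ) : ℝ) * Real.log ((max μ 2 : ℕ) : ℝ)) ^ 3) ≤ (S.card : ℝ) ∧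
        (∀ G ∈ S, ∀ H ∈ S, G ≠ H → IsEmpty (G.2 ≃g H.2)) ∧
        ∀ G ∈ S, G.1 ≤ n ∧ Is3ECTF G.2 ∧
          (∀ x y, x ≠ y → ¬ G.2.Adj x y → μ ≤ (G.2.commonNeighbors x y).ncard) ∧
          ∃ (t : ℕ) (T : Tournament (Fin t)), T.IsShattered ∧
            Nonempty (G.2 ≃g twistedGraph T 2 k hk) := by
  -- Here 64 = 4 · 16: the 4 comes from n ≤ 2At, the 16 from the exponent t²/16, and (4^7)^3 from A²
  -- = (4^k)^3.
  refine ⟨1 / (64 * (4 ^ 7) ^ 3), by positivity, fun μ => ?_⟩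
  set M := max μ 2 with hM
  have hM2 : 2 ≤ M := le_max_right _ _
  obtain ⟨k, hk7, hkM, hk4⟩ := exists_dimension M hM2
  have hk : 1 ≤ k := by omega
  obtain ⟨t₀, ht₀⟩ := Filter.eventually_atTop.1 (eventually_two_pow_le_card_isShattered.and
    (eventually_factorial_mul_le (2 ^ (3 * k)) (by positivity)))
  refine ⟨k, hk, 2 ^ (3 * k) * max t₀ 4, fun n hn => ?_⟩
  set A := 2 ^ (3 * k) with hA
  have hApos : 0 < A := by positivity
  set t := n / A with ht
  have htle : max t₀ 4 ≤ t := (Nat.le_div_iff_mul_le hApos).2 (by rwa [mul_comm])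
  have ht4 : 4 ≤ t := (le_max_right _ _).trans htle
  obtain ⟨hsh, hfac⟩ := ht₀ t ((le_max_left _ _).trans htle)
  have := Fintype.ofFinite (Tournament (Fin t))
  obtain ⟨S, hcard, hS, hST⟩ := exists_nonisomorphic_twistedGraphs (t := t) hk
  refine ⟨S.map ⟨Sigma.mk (t * A), sigma_mk_injective⟩, ?_, ?_, ?_⟩
  · rw [Finset.card_map]
    have hlogM : 0 < Real.log M := Real.log_pos (by exact_mod_cast hM2)
    have hMpos : (0 : ℝ) < M := by exact_mod_cast (by omega : 0 < M)
    have hL : 0 < ((M : ℝ) * Real.log M) ^ 3 := by positivity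
    have hA2 : (A : ℝ) ^ 2 ≤ (4 ^ 7) ^ 3 * ((M : ℝ) * Real.log M) ^ 3 := by
      have e : (A : ℝ) ^ 2 = (4 ^ k) ^ 3 := by
        rw [hA]
        push_cast
        rw [show (4 : ℝ) = 2 ^ 2 by norm_num, ← pow_mul, ← pow_mul, ← pow_mul]
        congr 1
        ring
      rw [e, ← mul_pow]
      exact pow_le_pow_left₀ (by positivity) hk4 3
    have hnt : (n : ℝ) ≤ 2 * (A * t) := by
      have h1 : n < A * (t + 1) := by
        rw [mul_comm]
        exact (Nat.div_lt_iff_lt_mul hApos).1 (Nat.lt_succ_self _)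
      have h2 : n ≤ 2 * (A * t) := by nlinarith
      exact_mod_cast h2
    have hexp : 1 / (64 * (4 ^ 7) ^ 3) * (n : ℝ) ^ 2 / ((M : ℝ) * Real.log M) ^ 3 ≤
        (t : ℝ) ^ 2 / 16 := by
      rw [div_le_iff₀ hL]
      have h1 : (n : ℝ) ^ 2 ≤ (2 * (A * t)) ^ 2 := pow_le_pow_left₀ (by positivity) hnt 2
      have h2 := mul_le_mul_of_nonneg_right hA2 (show (0 : ℝ) ≤ 4 * t ^ 2 by positivity)
      calc 1 / (64 * (4 ^ 7) ^ 3) * (n : ℝ) ^ 2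
          ≤ 1 / (64 * (4 ^ 7) ^ 3) * ((4 ^ 7) ^ 3 * ((M : ℝ) * Real.log M) ^ 3 * (4 * t ^ 2)) := by
            refine mul_le_mul_of_nonneg_left (h1.trans (le_trans (le_of_eq ?_) h2)) (by positivity)
            ring
        _ = (t : ℝ) ^ 2 / 16 * ((M : ℝ) * Real.log M) ^ 3 := by ring
    refine (Real.rpow_le_rpow_of_exponent_le one_le_two hexp).trans ?_
    have h1 : (2 : ℝ) ^ ((t / 2) * (t / 2)) ≤ 2 * ((t * A).factorial * S.card) := by
      have := hsh.trans (Nat.mul_le_mul_left 2 hcard)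
      exact_mod_cast this
    have hpos : (0 : ℝ) < 2 * ((t * A).factorial : ℝ) := by positivity
    refine le_of_mul_le_mul_left (hfac.trans (h1.trans (le_of_eq ?_))) hpos
    ring
  · intro G hG H hH hne
    obtain ⟨G, hG', rfl⟩ := Finset.mem_map.1 hG
    obtain ⟨H, hH', rfl⟩ := Finset.mem_map.1 hH
    exact hS G hG' H hH' fun e => hne (e ▸ rfl)
  · intro G hG
    obtain ⟨G, hG', rfl⟩ := Finset.mem_map.1 hG
    obtain ⟨T, hT, ⟨φ⟩⟩ := hST G hG'
    refine ⟨Nat.div_mul_le_self n A, (twistedGraph_is3ECTF ht4 hk hk7 hT).of_iso φ, ?_,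
      t, T, hT, ⟨φ⟩⟩
    intro x y _ hxy
    change μ ≤ (G.commonNeighbors x y).ncard
    have hadj : ¬ (twistedGraph T 2 k hk).Adj (φ x) (φ y) := fun h => hxy (φ.map_adj_iff.1 h)
    have hV : ∀ a : Fin t, ∃ b, b ≠ a := fun a =>
      have : Nontrivial (Fin t) := Fin.nontrivial_iff_two_le.2 (by omega)
      exists_ne a
    have h1 := centralBinom_le_ncard_commonNeighbors hk hV hadj
    rw [ncard_commonNeighbors_of_iso] at h1
    have : μ ≤ M := le_max_left _ _
    omega
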